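/- Let $\zeta$ be the Riemann zeta function, and call a zero of $\zeta$ nontrivial if it is not one of $-2,-4,-6,\dots$. Let $0<b\le \tfrac14$ and let $n$ be a positive integer with $n\le \frac1{2b}-1$; put $a=\frac{\pi n}{1/2-b}$. Then the functions $t\mapsto e^{-at}\ln|\zeta(b+it)|$ and $x\mapsto \sin(ax)\ln|\zeta(b+x)|$ are absolutely integrable on $(0,\infty)$, and the equality $$\int_0^\infty e^{-at}\ln|\zeta(b+it)|\,dt-\int_0^\infty \sin(ax)\ln|\zeta(b+x)|\,dx+\frac{\pi}{a}\sin(a(1-b))=0$$ holds if and only if $\zeta$ has no nontrivial zeros $s$ with $\operatorname{Re} s<b$. In particular (take $b=\tfrac14$, $n=1$, $a=4\pi$), the equality $$\int_0^\infty e^{-4\pi t}\ln|\zeta(\tfrac14+it)|\,dt-\int_0^\infty \sin(4\pi x)\ln|\zeta(\tfrac14+x)|\,dx=0$$ holds if and only if $\zeta$ has no nontrivial zeros $s$ with $\operatorname{Re} s<\tfrac14$. -/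

import Mathlib

/-- A nontrivial zero of the Riemann zeta function: a zero that is not one of `-2, -4, -6, …`. -/
def IsNontrivialZetaZero (s : ℂ) : Prop :=
  riemannZeta s = 0 ∧ ¬ ∃ k : ℕ, s = -2 * ((k : ℂ) + 1)

/-! Put u(z) = log|ζ(b + z)|. If sin(aX) = 0, the kernel sin(ax) sinh(a(T - |y|)) vanishes on the
boundary of [0, X] × [-T, T], is harmonic off the real axis, and has a jump of its normal derivative
across that axis. Green's formula (`stripFunctional_log_norm`) thus equates 2π times the sum of the
kernel over zeros minus poles, with multiplicity, to integrals of u over the edges and over the real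
segment. It is proved factor by factor from Cauchy's theorem for E'(z) log(c(z - w)), E =
`stripWeight`.

Take T = N and X = Nπ/a, divide by 2a sinh(aN) and let N tend to infinity. The left edge gives the
integral of exp(-at) u(it), the real segment gives minus the integral of sin(ax) u(x), and the other
edges vanish (`tendsto_stripFunctional_riemannZeta`). This needs linear growth of the integrals of
|log|ζ||. The upper bound for log|ζ| comes from the completed zeta function; the bound from below,
in mean, comes from the same Green's formula on a rectangle turned by a right angle
(`integral_log_riemannZeta_edges_le`).

On the side of the zeros, the pole at 1 gives the term in sin(a(1 - b)). Since a(1 - 2b) = 2πn, the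
kernel is odd under s ↦ 1 - s in b ≤ Re s ≤ 1 - b, whereas orders are invariant by the functional
equation, so the zeros there cancel (`finsum_zetaOrder_mul_stripKernel`). What remains are the zeros
with 1 - b < Re s < 1. The bound on n says ab ≤ π, which makes their weights positive
(`sin_mul_sub_pos`). The expression in the theorem is therefore a limit of nonnegative sums, in
which each such zero has a positive limiting contribution. It vanishes exactly when there are none,
and s ↦ 1 - s carries them to the nontrivial zeros with Re s < b. -/

/-! ### Cauchy's theorem on rectangles with a logarithmic singularity on the boundary. -/

section RectangleIntegrals

open Complex Set Filter Topology MeasureTheory intervalIntegral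
open scoped Interval

/-- The integral of `F` along the boundary of the rectangle `[0, X] × [y₁, y₂]` vanishes. -/
def RectIntegralZero (F : ℂ → ℂ) (X y₁ y₂ : ℝ) : Prop :=
  (∫ x : ℝ in (0 : ℝ)..X, F (x + y₁ * I)) - (∫ x : ℝ in (0 : ℝ)..X, F (x + y₂ * I)) +
    I * (∫ y : ℝ in y₁..y₂, F (X + y * I)) - I * (∫ y : ℝ in y₁..y₂, F (y * I)) = 0

theorem rectIntegralZero_of_differentiableOn {F : ℂ → ℂ} {X y₁ y₂ : ℝ}
    (hF : DifferentiableOn ℂ F ([[0, X]] ×ℂ [[y₁, y₂]])) : RectIntegralZero F X y₁ y₂ := by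
  have := integral_boundary_rect_eq_zero_of_differentiableOn F (y₁ * I) (X + y₂ * I)
    (by simpa using hF)
  simpa [RectIntegralZero] using this

theorem continuousAt_mul_log_zero : ContinuousAt (fun z : ℂ => z * log z) 0 := by
  have h1 : Tendsto (fun z : ℂ => ‖z‖ * |Real.log ‖z‖| + ‖z‖ * Real.pi) (𝓝 0) (𝓝 0) := by
    have h2 : Continuous (fun z : ℂ => |‖z‖ * Real.log ‖z‖| + ‖z‖ * Real.pi) :=
      ((Real.continuous_mul_log.comp continuous_norm).abs).add
        (continuous_norm.mul continuous_const)
    have := h2.tendsto 0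
    simpa [abs_mul] using this
  rw [ContinuousAt]
  simp only [log_zero, mul_zero]
  refine squeeze_zero_norm (fun z => ?_) h1
  rw [norm_mul, ← mul_add]
  refine mul_le_mul_of_nonneg_left ?_ (norm_nonneg _)
  refine (norm_le_abs_re_add_abs_im _).trans ?_
  rw [log_re, log_im]
  exact add_le_add le_rfl (abs_arg_le_pi z)

theorem mem_slitPlane_of_re_nonneg {z : ℂ} (hz : 0 ≤ z.re) (h0 : z ≠ 0) : z ∈ slitPlane := by
  rw [mem_slitPlane_iff]
  rcases hz.lt_or_eq with h | h
  · exact Or.inl h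
  · right
    intro h'
    exact h0 (Complex.ext h.symm h')

theorem continuousAt_mul_log_of_re_nonneg {z : ℂ} (hz : 0 ≤ z.re) :
    ContinuousAt (fun z : ℂ => z * log z) z := by
  rcases eq_or_ne z 0 with rfl | h0
  · exact continuousAt_mul_log_zero
  · exact continuousAt_id.mul (continuousAt_clog (mem_slitPlane_of_re_nonneg hz h0))

theorem intervalIntegrable_log_norm_line (w p q : ℂ) (α β : ℝ) :
    IntervalIntegrable (fun t : ℝ => Real.log ‖p + t * q - w‖) volume α β := by
  have : MeromorphicOn (fun t : ℝ => p + t * q - w) [[α, β]] := by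
    intro t _
    apply AnalyticAt.meromorphicAt
    have : AnalyticAt ℝ (fun t : ℝ => (t : ℂ)) t := ofRealCLM.analyticAt t
    fun_prop
  exact this.intervalIntegrable_log_norm

theorem norm_log_le_abs_log_norm_add_pi (z : ℂ) : ‖log z‖ ≤ |Real.log ‖z‖| + Real.pi := by
  refine (norm_le_abs_re_add_abs_im _).trans ?_
  rw [log_re, log_im]
  exact add_le_add le_rfl (abs_arg_le_pi z)

theorem intervalIntegrable_log_line (w p q c : ℂ) (hc : ‖c‖ = 1) (α β : ℝ) :
    IntervalIntegrable (fun t : ℝ => log (c * (p + t * q - w))) volume α β := by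
  have h := ((intervalIntegrable_log_norm_line w p q α β).abs).add
    (_root_.intervalIntegrable_const (c := Real.pi))
  refine h.mono_fun ?_ ?_
  · apply Measurable.aestronglyMeasurable
    fun_prop
  · refine Eventually.of_forall fun t => ?_
    refine (norm_log_le_abs_log_norm_add_pi _).trans ?_
    simp only [norm_mul, hc, one_mul, Real.norm_eq_abs]
    exact le_abs_self _

/-- The fundamental theorem of calculus for `(E - E w) · log` along a segment in the closed half
plane where `log (c * (z - w))` is continuous off `w`. -/
theorem integral_deriv_mul_log_line {E : ℂ → ℂ} (hE : Differentiable ℂ E) (w p q c : ℂ)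
    (hc : ‖c‖ = 1) (hq : q ≠ 0) {α β : ℝ} (hle : α ≤ β)
    (hre : ∀ t ∈ Icc α β, 0 ≤ (c * (p + t * q - w)).re) :
    q * (∫ t in α..β, deriv E (p + t * q) * log (c * (p + t * q - w))) +
      q * (∫ t in α..β, dslope E w (p + t * q)) =
      (E (p + β * q) - E w) * log (c * (p + β * q - w)) -
      (E (p + α * q) - E w) * log (c * (p + α * q - w)) := by
  have hc0 : c ≠ 0 := by
    rintro rfl
    simp at hc
  have hγ : Continuous (fun t : ℝ => p + t * q) := by fun_prop
  have hD : Differentiable ℂ (dslope E w) := by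
    rw [← differentiableOn_univ, Complex.differentiableOn_dslope univ_mem]
    exact hE.differentiableOn
  have hE' : Continuous (deriv E) := (hE.contDiff (n := 1)).continuous_deriv le_rfl
  have hi1 : IntervalIntegrable (fun t : ℝ => deriv E (p + t * q) * log (c * (p + t * q - w)))
      volume α β :=
    (intervalIntegrable_log_line w p q c hc α β).continuousOn_mul
      (hE'.comp hγ).continuousOn
  have hi2 : IntervalIntegrable (fun t : ℝ => dslope E w (p + t * q)) volume α β :=
    (hD.continuous.comp hγ).intervalIntegrable _ _
  rw [← intervalIntegral.integral_const_mul, ← intervalIntegral.integral_const_mul,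
    ← intervalIntegral.integral_add (hi1.const_mul q) (hi2.const_mul q)]
  -- Subtracting E w tames the singularity: the product is an entire function times ζ log ζ with ζ =
  -- c(z - w), which is continuous on the closed right half plane, including 0 where `log 0 = 0`.
  have key : ∀ z, (E z - E w) * log (c * (z - w)) =
      c⁻¹ * dslope E w z * (c * (z - w) * log (c * (z - w))) := by
    intro z
    have := sub_smul_dslope E w z
    rw [smul_eq_mul] at this
    rw [← this]
    field_simp
  refine integral_eq_of_hasDerivAt_off_countable_of_le
    (fun t : ℝ => (E (p + t * q) - E w) * log (c * (p + t * q - w))) _ hle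
    (s := {t : ℝ | p + t * q = w}) ?_ ?_ ?_ ((hi1.const_mul q).add (hi2.const_mul q))
  · apply Set.Subsingleton.countable
    intro s hs t ht
    have : (s : ℂ) * q = t * q := add_left_cancel (hs.trans ht.symm)
    exact_mod_cast mul_right_cancel₀ hq this
  · simp_rw [key]
    apply ContinuousOn.mul
    · exact (continuous_const.mul (hD.continuous.comp hγ)).continuousOn
    · intro t ht
      have h1 := continuousAt_mul_log_of_re_nonneg (hre t ht)
      have h2 : ContinuousAt (fun t : ℝ => c * (p + t * q - w)) t := by fun_prop
      exact (ContinuousAt.comp (f := fun t : ℝ => c * (p + t * q - w)) h1 h2).continuousWithinAt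
  · intro t ht
    have hne : p + t * q ≠ w := ht.2
    have hsl : c * (p + t * q - w) ∈ slitPlane :=
      mem_slitPlane_of_re_nonneg (hre t (Ioo_subset_Icc_self ht.1))
        (mul_ne_zero hc0 (sub_ne_zero.2 hne))
    have hz : HasDerivAt (fun z : ℂ => (E z - E w) * log (c * (z - w)))
        (deriv E (p + t * q) * log (c * (p + t * q - w)) + dslope E w (p + t * q))
        (p + t * q) := by
      have h1 := (hE (p + t * q)).hasDerivAt.sub_const (E w)
      have h2 : HasDerivAt (fun z : ℂ => c * (z - w)) c (p + t * q) := by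
        simpa using ((hasDerivAt_id (p + t * q)).sub_const w).const_mul c
      have h3 := h1.mul (h2.clog hsl)
      refine h3.congr_deriv ?_
      rw [dslope_of_ne _ hne, slope_def_field]
      have : p + t * q - w ≠ 0 := sub_ne_zero.2 hne
      field_simp
    have hγ' : HasDerivAt (fun t : ℝ => p + t * q) q t := by
      simpa using ((ofRealCLM.hasDerivAt (x := t)).mul_const q).const_add p
    refine (hz.comp t hγ').congr_deriv ?_
    ring

/-- On each side (E - E w) log is a primitive of E' log + `dslope E w`. The corner values cancel
around the rectangle and the entire function `dslope E w` integrates to zero. The unit c turns the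
rectangle into the right half plane, away from the branch cut, and w may lie on the boundary. -/
theorem rectIntegralZero_deriv_mul_log {E : ℂ → ℂ} (hE : Differentiable ℂ E) (w c : ℂ)
    (hc : ‖c‖ = 1) {X y₁ y₂ : ℝ} (hX : 0 ≤ X) (hy : y₁ ≤ y₂)
    (hre : ∀ x ∈ Icc 0 X, ∀ y ∈ Icc y₁ y₂, 0 ≤ (c * (x + y * I - w)).re) :
    RectIntegralZero (fun z => deriv E z * log (c * (z - w))) X y₁ y₂ := by
  have hD : Differentiable ℂ (dslope E w) := by
    rw [← differentiableOn_univ, Complex.differentiableOn_dslope univ_mem]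
    exact hE.differentiableOn
  have h0 := rectIntegralZero_of_differentiableOn (X := X) (y₁ := y₁) (y₂ := y₂)
    hD.differentiableOn
  have b := integral_deriv_mul_log_line hE w (y₁ * I) 1 c hc one_ne_zero hX
    (fun t ht => by simpa [add_comm] using hre t ht y₁ (left_mem_Icc.2 hy))
  have u := integral_deriv_mul_log_line hE w (y₂ * I) 1 c hc one_ne_zero hX
    (fun t ht => by simpa [add_comm] using hre t ht y₂ (right_mem_Icc.2 hy))
  have r := integral_deriv_mul_log_line hE w X I c hc I_ne_zero hy
    (fun t ht => by simpa using hre X (right_mem_Icc.2 hX) t ht)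
  have l := integral_deriv_mul_log_line hE w 0 I c hc I_ne_zero hy
    (fun t ht => by simpa using hre 0 (left_mem_Icc.2 hX) t ht)
  simp only [mul_one, one_mul, zero_add, ofReal_zero, add_zero] at b u r l
  simp only [add_comm ((y₁ : ℂ) * I)] at b
  simp only [add_comm ((y₂ : ℂ) * I)] at u
  unfold RectIntegralZero at h0 ⊢
  linear_combination b - u + r - l - h0

end RectangleIntegrals

/-! ### Real parts of the Cauchy relations for the upper half of the rectangle. -/

section HalfStrip

open Complex Set Filter Topology MeasureTheory intervalIntegral
open scoped Interval

/-- The holomorphic weight whose imaginary part on the upper half of the rectangle is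
`sin (a x) sinh (a (T - y))`. -/
noncomputable def stripWeight (a T : ℝ) (z : ℂ) : ℂ := cos (a * (z - T * I))

theorem differentiable_stripWeight (a T : ℝ) : Differentiable ℂ (stripWeight a T) := by
  unfold stripWeight
  fun_prop

theorem deriv_stripWeight (a T : ℝ) (z : ℂ) :
    deriv (stripWeight a T) z = -(a * sin (a * (z - T * I))) := by
  have h : HasDerivAt (fun z : ℂ => (a : ℂ) * (z - T * I)) a z := by
    simpa using ((hasDerivAt_id z).sub_const (T * I)).const_mul (a : ℂ)
  unfold stripWeight
  rw [h.ccos.deriv]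
  ring

theorem continuous_deriv_stripWeight (a T : ℝ) : Continuous (deriv (stripWeight a T)) := by
  rw [show deriv (stripWeight a T) = _ from funext (deriv_stripWeight a T)]
  fun_prop

theorem deriv_stripWeight_apply (a T x y : ℝ) :
    deriv (stripWeight a T) (x + y * I) =
      -((a * Real.sin (a * x) * Real.cosh (a * (T - y)) : ℝ) : ℂ) +
        ((a * Real.cos (a * x) * Real.sinh (a * (T - y)) : ℝ) : ℂ) * I := by
  rw [deriv_stripWeight]
  have h1 : (a : ℂ) * (x + y * I - T * I) = ((a * x : ℝ) : ℂ) + ((-(a * (T - y)) : ℝ) : ℂ) * I := by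
    push_cast
    ring
  rw [h1, sin_add_mul_I, ← ofReal_sin, ← ofReal_cos, ← ofReal_cosh, ← ofReal_sinh, Real.sinh_neg,
    Real.cosh_neg]
  push_cast
  ring

/-- The boundary functional of the rectangle `[0, X] × [0, T]`. -/
noncomputable def halfStripFunctional (a T X : ℝ) (u : ℂ → ℝ) : ℝ :=
  (∫ y in (0 : ℝ)..T, a * Real.sinh (a * (T - y)) * u (y * I)) -
    Real.cos (a * X) * (∫ y in (0 : ℝ)..T, a * Real.sinh (a * (T - y)) * u (X + y * I)) +
    (∫ x in (0 : ℝ)..X, a * Real.sin (a * x) * u (x + T * I)) -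
    a * Real.cosh (a * T) * ∫ x in (0 : ℝ)..X, Real.sin (a * x) * u x

/-- On the vertical sides the weight is purely imaginary because sin(ax) vanishes at 0 and X, so
only Re h enters there. -/
theorem re_rectIntegralZero {a T X y₁ y₂ : ℝ} {h : ℂ → ℂ} (hX : Real.sin (a * X) = 0)
    (hh : RectIntegralZero (fun z => deriv (stripWeight a T) z * h z) X y₁ y₂)
    (hl : IntervalIntegrable (fun y : ℝ => h (y * I)) volume y₁ y₂)
    (hr : IntervalIntegrable (fun y : ℝ => h (X + y * I)) volume y₁ y₂) :
    (∫ x in (0 : ℝ)..X, deriv (stripWeight a T) (x + y₁ * I) * h (x + y₁ * I)).re -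
      (∫ x in (0 : ℝ)..X, deriv (stripWeight a T) (x + y₂ * I) * h (x + y₂ * I)).re +
      (∫ y in y₁..y₂, a * Real.sinh (a * (T - y)) * (h (y * I)).re) -
      Real.cos (a * X) * (∫ y in y₁..y₂, a * Real.sinh (a * (T - y)) * (h (X + y * I)).re) = 0 := by
  have e1 : ∀ y : ℝ, deriv (stripWeight a T) (y * I) =
      ((a * Real.sinh (a * (T - y)) : ℝ) : ℂ) * I := by
    intro y
    have := deriv_stripWeight_apply a T 0 y
    simpa using this
  have e2 : ∀ y : ℝ, deriv (stripWeight a T) (X + y * I) =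
      ((Real.cos (a * X) : ℝ) : ℂ) * (((a * Real.sinh (a * (T - y)) : ℝ) : ℂ) * I) := by
    intro y
    rw [deriv_stripWeight_apply, hX]
    push_cast
    ring
  have hs : Continuous (fun y : ℝ => ((a * Real.sinh (a * (T - y)) : ℝ) : ℂ)) := by fun_prop
  have r1 : (∫ y in y₁..y₂, ((a * Real.sinh (a * (T - y)) : ℝ) : ℂ) * h (y * I)).re =
      ∫ y in y₁..y₂, a * Real.sinh (a * (T - y)) * (h (y * I)).re := by
    have := reCLM.intervalIntegral_comp_comm (hl.continuousOn_mul hs.continuousOn)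
    simp only [reCLM_apply, re_ofReal_mul] at this
    exact this.symm
  have r2 : (∫ y in y₁..y₂, ((a * Real.sinh (a * (T - y)) : ℝ) : ℂ) * h (X + y * I)).re =
      ∫ y in y₁..y₂, a * Real.sinh (a * (T - y)) * (h (X + y * I)).re := by
    have := reCLM.intervalIntegral_comp_comm (hr.continuousOn_mul hs.continuousOn)
    simp only [reCLM_apply, re_ofReal_mul] at this
    exact this.symm
  unfold RectIntegralZero at hh
  have i1 : (∫ y : ℝ in y₁..y₂, deriv (stripWeight a T) (y * I) * h (y * I)) =
      I * ∫ y in y₁..y₂, ((a * Real.sinh (a * (T - y)) : ℝ) : ℂ) * h (y * I) := by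
    rw [← intervalIntegral.integral_const_mul]
    refine integral_congr fun y _ => ?_
    simp only [e1]
    ring
  have i2 : (∫ y : ℝ in y₁..y₂, deriv (stripWeight a T) (X + y * I) * h (X + y * I)) =
      I * (((Real.cos (a * X) : ℝ) : ℂ) *
        ∫ y in y₁..y₂, ((a * Real.sinh (a * (T - y)) : ℝ) : ℂ) * h (X + y * I)) := by
    rw [← intervalIntegral.integral_const_mul, ← intervalIntegral.integral_const_mul]
    refine integral_congr fun y _ => ?_
    simp only [e2]
    ring
  simp only [i1, i2] at hh
  rw [← mul_assoc I I, ← mul_assoc I I, I_mul_I] at hh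
  have := congrArg re hh
  simp only [add_re, sub_re, neg_mul, one_mul, neg_re, re_ofReal_mul, zero_re, r1, r2] at this
  linarith

/-- Im h survives on the real axis only; at height T its coefficient contains sinh 0. The surviving
term is cancelled later by reflection in the real axis. -/
theorem re_integral_bottom {a T X : ℝ} {h : ℂ → ℂ}
    (hb : IntervalIntegrable (fun x : ℝ => h x) volume 0 X) :
    (∫ x in (0 : ℝ)..X, deriv (stripWeight a T) (x + (0 : ℝ) * I) * h (x + (0 : ℝ) * I)).re =
      -(a * Real.cosh (a * T) * ∫ x in (0 : ℝ)..X, Real.sin (a * x) * (h x).re) -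
        a * Real.sinh (a * T) * ∫ x in (0 : ℝ)..X, Real.cos (a * x) * (h x).im := by
  have hc : Continuous (fun x : ℝ => deriv (stripWeight a T) x) :=
    (continuous_deriv_stripWeight a T).comp continuous_ofReal
  have := reCLM.intervalIntegral_comp_comm (hb.continuousOn_mul hc.continuousOn)
  simp only [ofReal_zero, zero_mul, add_zero]
  simp only [reCLM_apply] at this
  rw [← this]
  have hre : IntervalIntegrable (fun x : ℝ => (h x).re) volume 0 X :=
    ⟨hb.1.re, hb.2.re⟩
  have him : IntervalIntegrable (fun x : ℝ => (h x).im) volume 0 X :=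
    ⟨hb.1.im, hb.2.im⟩
  have hs : Continuous (fun x : ℝ => Real.sin (a * x)) := by fun_prop
  have hco : Continuous (fun x : ℝ => Real.cos (a * x)) := by fun_prop
  rw [← neg_mul, ← intervalIntegral.integral_const_mul, ← intervalIntegral.integral_const_mul,
    ← intervalIntegral.integral_sub ((hre.continuousOn_mul hs.continuousOn).const_mul _)
      ((him.continuousOn_mul hco.continuousOn).const_mul _)]
  refine integral_congr fun x _ => ?_
  have := deriv_stripWeight_apply a T x 0
  simp only [ofReal_zero, zero_mul, add_zero, sub_zero] at this
  simp only [this, mul_re, add_re, add_im, neg_re, neg_im, ofReal_re, ofReal_im, I_re, I_im, mul_im]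
  ring

theorem re_integral_top {a T X : ℝ} {h : ℂ → ℂ}
    (hb : IntervalIntegrable (fun x : ℝ => h (x + T * I)) volume 0 X) :
    (∫ x in (0 : ℝ)..X, deriv (stripWeight a T) (x + T * I) * h (x + T * I)).re =
      -∫ x in (0 : ℝ)..X, a * Real.sin (a * x) * (h (x + T * I)).re := by
  have hc : Continuous (fun x : ℝ => deriv (stripWeight a T) (x + T * I)) :=
    (continuous_deriv_stripWeight a T).comp (by fun_prop)
  have := reCLM.intervalIntegral_comp_comm (hb.continuousOn_mul hc.continuousOn)
  simp only [reCLM_apply] at this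
  rw [← this, ← intervalIntegral.integral_neg]
  refine integral_congr fun x _ => ?_
  simp only [deriv_stripWeight_apply, mul_re, add_re, add_im, neg_re, neg_im, ofReal_re, ofReal_im,
    I_re, I_im, sub_self, mul_zero, Real.sinh_zero, Real.cosh_zero, mul_im]
  ring

theorem halfStripFunctional_re {a T X : ℝ} {h : ℂ → ℂ} (hX : Real.sin (a * X) = 0)
    (hh : RectIntegralZero (fun z => deriv (stripWeight a T) z * h z) X 0 T)
    (hl : IntervalIntegrable (fun y : ℝ => h (y * I)) volume 0 T)
    (hr : IntervalIntegrable (fun y : ℝ => h (X + y * I)) volume 0 T)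
    (hb : IntervalIntegrable (fun x : ℝ => h x) volume 0 X)
    (ht : IntervalIntegrable (fun x : ℝ => h (x + T * I)) volume 0 X) :
    halfStripFunctional a T X (fun z => (h z).re) =
      a * Real.sinh (a * T) * ∫ x in (0 : ℝ)..X, Real.cos (a * x) * (h x).im := by
  have := re_rectIntegralZero hX hh hl hr
  rw [re_integral_bottom hb, re_integral_top ht] at this
  unfold halfStripFunctional
  linarith

/-- Integrates the jump of the argument at height Im w against the weight. Since sin(ax) vanishes at
both ends, only its value at the source ξ = Re w is left. -/
theorem integral_sign_mul_cos {a X ξ : ℝ} (hX0 : 0 ≤ X) (hX : Real.sin (a * X) = 0) :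
    (∫ x in (0 : ℝ)..X, (SignType.sign (x - ξ) : ℝ) * (a * Real.cos (a * x))) =
      if 0 ≤ ξ ∧ ξ ≤ X then -2 * Real.sin (a * ξ) else 0 := by
  have hF : ∀ p q : ℝ, (∫ x in p..q, a * Real.cos (a * x)) = Real.sin (a * q) - Real.sin (a * p) := by
    intro p q
    refine integral_eq_sub_of_hasDerivAt (f := fun x => Real.sin (a * x)) (fun x _ => ?_)
      (Continuous.intervalIntegrable (by fun_prop) _ _)
    have : HasDerivAt (fun x : ℝ => a * x) a x := by simpa using (hasDerivAt_id x).const_mul a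
    simpa [mul_comm] using this.sin
  have hpos : ∀ p q : ℝ, p ≤ q → ξ ≤ p →
      (∫ x in p..q, (SignType.sign (x - ξ) : ℝ) * (a * Real.cos (a * x))) =
        ∫ x in p..q, a * Real.cos (a * x) := by
    intro p q hpq hp
    rw [integral_of_le hpq, integral_of_le hpq]
    refine setIntegral_congr_fun measurableSet_Ioc fun x hx => ?_
    have : 0 < x - ξ := by linarith [hx.1]
    simp [sign_pos this]
  have hneg : ∀ p q : ℝ, p ≤ q → q ≤ ξ →
      (∫ x in p..q, (SignType.sign (x - ξ) : ℝ) * (a * Real.cos (a * x))) =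
        -∫ x in p..q, a * Real.cos (a * x) := by
    intro p q hpq hp
    rw [integral_of_le hpq, integral_of_le hpq, integral_Ioc_eq_integral_Ioo,
      integral_Ioc_eq_integral_Ioo, ← MeasureTheory.integral_neg]
    refine setIntegral_congr_fun measurableSet_Ioo fun x hx => ?_
    have : x - ξ < 0 := by linarith [hx.2]
    simp [sign_neg this]
  have hint : ∀ p q : ℝ, IntervalIntegrable
      (fun x => (SignType.sign (x - ξ) : ℝ) * (a * Real.cos (a * x))) volume p q := by
    intro p q
    have h1 : IntervalIntegrable (fun x => a * Real.cos (a * x)) volume p q :=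
      Continuous.intervalIntegrable (by fun_prop) _ _
    refine h1.mono_fun ?_ (Eventually.of_forall fun x => ?_)
    · apply Measurable.aestronglyMeasurable
      have : Measurable (fun x : ℝ => (SignType.sign (x - ξ) : ℝ)) := by
        have e : (fun x : ℝ => (SignType.sign (x - ξ) : ℝ)) =
            fun x => if ξ < x then 1 else if x < ξ then -1 else 0 := by
          ext x
          rcases lt_trichotomy x ξ with h | h | h
          · simp [sign_neg (sub_neg.2 h), h, h.not_gt]
          · simp [h]
          · simp [sign_pos (sub_pos.2 h), h]
        rw [e]
        exact Measurable.ite measurableSet_Ioi measurable_const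
          (Measurable.ite measurableSet_Iio measurable_const measurable_const)
      exact this.mul (by fun_prop)
    · beta_reduce
      rw [norm_mul]
      refine mul_le_of_le_one_left (norm_nonneg _) ?_
      rcases lt_trichotomy (x - ξ) 0 with h | h | h
      · simp [sign_neg h]
      · simp [h]
      · simp [sign_pos h]
  split_ifs with h
  · rw [← integral_add_adjacent_intervals (hint 0 ξ) (hint ξ X), hneg 0 ξ h.1 le_rfl,
      hpos ξ X h.2 le_rfl, hF, hF, hX]
    simp
    ring
  · rw [not_and_or, not_le, not_le] at h
    rcases h with h | h
    · rw [hpos 0 X hX0 h.le, hF, hX]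
      simp
    · rw [hneg 0 X hX0 h.le, hF, hX]
      simp

theorem log_I_mul_sub_log_neg_I_mul {r : ℝ} (hr : r ≠ 0) :
    log (I * r) - log (-I * r) = (SignType.sign r : ℝ) * Real.pi * I := by
  rcases hr.lt_or_gt with h | h
  · have h1 : I * (r : ℂ) = ((-r : ℝ) : ℂ) * -I := by push_cast; ring
    have h2 : -I * (r : ℂ) = ((-r : ℝ) : ℂ) * I := by push_cast; ring
    rw [h1, h2, log_ofReal_mul (neg_pos.2 h) (by simp), log_ofReal_mul (neg_pos.2 h) (by simp),
      log_I, log_neg_I, (by simp [sign_neg h] : (SignType.sign r : ℝ) = -1)]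
    push_cast
    ring
  · rw [mul_comm I, mul_comm (-I), log_ofReal_mul h (by simp), log_ofReal_mul h (by simp),
      log_I, log_neg_I, (by simp [sign_pos h] : (SignType.sign r : ℝ) = 1)]
    push_cast
    ring

end HalfStrip

/-! ### Green's formula for log|z - w|, and linearity of the boundary functional. -/

section StripFunctional

open Complex Set Filter Topology MeasureTheory intervalIntegral ComplexConjugate
open scoped Interval

theorem re_log_unit_mul {c : ℂ} (hc : ‖c‖ = 1) (z : ℂ) : (log (c * z)).re = Real.log ‖z‖ := by
  rw [log_re, norm_mul, hc, one_mul]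

theorem intervalIntegrable_log_edges (w c : ℂ) (hc : ‖c‖ = 1) (T X y₁ y₂ : ℝ) :
    IntervalIntegrable (fun y : ℝ => log (c * (y * I - w))) volume y₁ y₂ ∧
    IntervalIntegrable (fun y : ℝ => log (c * (X + y * I - w))) volume y₁ y₂ ∧
    IntervalIntegrable (fun x : ℝ => log (c * (x - w))) volume 0 X ∧
    IntervalIntegrable (fun x : ℝ => log (c * (x + T * I - w))) volume 0 X := by
  refine ⟨?_, intervalIntegrable_log_line w X I c hc _ _, ?_, ?_⟩
  · simpa using intervalIntegrable_log_line w 0 I c hc y₁ y₂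
  · simpa using intervalIntegrable_log_line w 0 1 c hc 0 X
  · simpa [add_comm] using intervalIntegrable_log_line w (T * I) 1 c hc 0 X

theorem rectIntegralZero_log_above (a T : ℝ) {X y₁ y₂ : ℝ} (w : ℂ) (hX : 0 ≤ X) (hy : y₁ ≤ y₂)
    (hw : w.im ≤ y₁) :
    RectIntegralZero (fun z => deriv (stripWeight a T) z * log (-I * (z - w))) X y₁ y₂ := by
  refine rectIntegralZero_deriv_mul_log (differentiable_stripWeight a T) w (-I) (by simp) hX hy ?_
  intro x _ y hy
  simp
  linarith [hy.1]

theorem rectIntegralZero_log_below (a T : ℝ) {X y₁ y₂ : ℝ} (w : ℂ) (hX : 0 ≤ X) (hy : y₁ ≤ y₂)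
    (hw : y₂ ≤ w.im) :
    RectIntegralZero (fun z => deriv (stripWeight a T) z * log (I * (z - w))) X y₁ y₂ := by
  refine rectIntegralZero_deriv_mul_log (differentiable_stripWeight a T) w I (by simp) hX hy ?_
  intro x _ y hy
  simp
  linarith [hy.2]

theorem halfStripFunctional_log_of_im_nonpos {a T X : ℝ} (hT : 0 ≤ T) (hX0 : 0 ≤ X)
    (hX : Real.sin (a * X) = 0) {w : ℂ} (hw : w.im ≤ 0) :
    halfStripFunctional a T X (fun z => Real.log ‖z - w‖) =
      a * Real.sinh (a * T) * ∫ x in (0 : ℝ)..X, Real.cos (a * x) * (log (-I * (x - w))).im := by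
  obtain ⟨h1, h2, h3, h4⟩ := intervalIntegrable_log_edges w (-I) (by simp) T X 0 T
  have := halfStripFunctional_re (h := fun z => log (-I * (z - w))) hX
    (rectIntegralZero_log_above a T w hX0 hT hw) h1 h2 h3 h4
  simpa only [re_log_unit_mul (c := -I) (by simp)] using this

/-- The Green kernel `sin (a x) sinh (a (T - |y|))` of the rectangle `[0, X] × [-T, T]`. -/
noncomputable def stripKernel (a T X : ℝ) (w : ℂ) : ℝ :=
  open Classical in
  if (0 ≤ w.re ∧ w.re ≤ X) ∧ |w.im| ≤ T then Real.sin (a * w.re) * Real.sinh (a * (T - |w.im|))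
  else 0

theorem re_integral_log_jump {a T X : ℝ} (hX0 : 0 ≤ X) (hX : Real.sin (a * X) = 0) (w : ℂ) :
    (∫ x in (0 : ℝ)..X, deriv (stripWeight a T) (x + w.im * I) * log (I * (x + w.im * I - w))).re -
      (∫ x in (0 : ℝ)..X,
        deriv (stripWeight a T) (x + w.im * I) * log (-I * (x + w.im * I - w))).re =
      -Real.sinh (a * (T - w.im)) * Real.pi *
        if 0 ≤ w.re ∧ w.re ≤ X then -2 * Real.sin (a * w.re) else 0 := by
  have hc : Continuous (fun x : ℝ => deriv (stripWeight a T) (x + w.im * I)) :=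
    (continuous_deriv_stripWeight a T).comp (by fun_prop)
  have i1 := (intervalIntegrable_log_edges w I (by simp) w.im X 0 0).2.2.2.continuousOn_mul
    hc.continuousOn
  have i2 := (intervalIntegrable_log_edges w (-I) (by simp) w.im X 0 0).2.2.2.continuousOn_mul
    hc.continuousOn
  have hre := reCLM.intervalIntegral_comp_comm (i1.sub i2)
  rw [← sub_re, ← intervalIntegral.integral_sub i1 i2]
  simp only [reCLM_apply] at hre
  rw [← hre, ← integral_sign_mul_cos hX0 hX, ← intervalIntegral.integral_const_mul]
  refine integral_congr_ae ?_
  have hne : ∀ᵐ x : ℝ, x ≠ w.re := by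
    simp [ae_iff, measure_singleton]
  filter_upwards [hne] with x hx _
  have e : (x : ℂ) + w.im * I - w = ((x - w.re : ℝ) : ℂ) := by
    apply Complex.ext <;> simp
  rw [← mul_sub, e, log_I_mul_sub_log_neg_I_mul (sub_ne_zero.2 hx), deriv_stripWeight_apply]
  simp only [mul_re, add_re, add_im, neg_re, neg_im, ofReal_re, ofReal_im, I_re, I_im, mul_im]
  ring

/-- If Im w ≤ T, the rectangle is cut at height Im w, with log(I(z - w)) used below and log(-I(z -
w)) above. Both branches have real part log|z - w|, so the vertical sides add up, and their mismatch
along the cut is the kernel term. If Im w > T one branch suffices and the kernel is zero. -/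
theorem halfStripFunctional_log_of_im_nonneg {a T X : ℝ} (hT : 0 ≤ T) (hX0 : 0 ≤ X)
    (hX : Real.sin (a * X) = 0) {w : ℂ} (hw : 0 ≤ w.im) :
    halfStripFunctional a T X (fun z => Real.log ‖z - w‖) =
      a * Real.sinh (a * T) * (∫ x in (0 : ℝ)..X, Real.cos (a * x) * (log (I * (x - w))).im) +
        2 * Real.pi * stripKernel a T X w := by
  rcases lt_or_ge T w.im with h | h
  · obtain ⟨h1, h2, h3, h4⟩ := intervalIntegrable_log_edges w I (by simp) T X 0 T
    have := halfStripFunctional_re (h := fun z => log (I * (z - w))) hX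
      (rectIntegralZero_log_below a T w hX0 hT h.le) h1 h2 h3 h4
    have hk : stripKernel a T X w = 0 := by
      rw [stripKernel, if_neg]
      rintro ⟨-, h'⟩
      rw [abs_of_nonneg hw] at h'
      linarith
    rw [hk, mul_zero, add_zero]
    simpa only [re_log_unit_mul (c := I) (by simp)] using this
  · obtain ⟨l1, r1, b1, -⟩ := intervalIntegrable_log_edges w I (by simp) T X 0 w.im
    obtain ⟨l2, r2, -, t2⟩ := intervalIntegrable_log_edges w (-I) (by simp) T X w.im T
    have e1 := re_rectIntegralZero (h := fun z => log (I * (z - w))) hX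
      (rectIntegralZero_log_below a T w hX0 hw le_rfl) l1 r1
    have e2 := re_rectIntegralZero (h := fun z => log (-I * (z - w))) hX
      (rectIntegralZero_log_above a T w hX0 h le_rfl) l2 r2
    rw [re_integral_bottom (h := fun z => log (I * (z - w))) b1] at e1
    rw [re_integral_top (h := fun z => log (-I * (z - w))) t2] at e2
    have ej := re_integral_log_jump (T := T) hX0 hX w
    simp only [re_log_unit_mul (c := I) (by simp), re_log_unit_mul (c := -I) (by simp)] at e1 e2
    have hs : Continuous (fun y : ℝ => a * Real.sinh (a * (T - y))) := by fun_prop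
    have hl : ∀ p q : ℝ, IntervalIntegrable
        (fun y : ℝ => a * Real.sinh (a * (T - y)) * Real.log ‖y * I - w‖) volume p q := fun p q =>
      IntervalIntegrable.continuousOn_mul
        (by simpa using intervalIntegrable_log_norm_line w 0 I p q) hs.continuousOn
    have hr : ∀ p q : ℝ, IntervalIntegrable
        (fun y : ℝ => a * Real.sinh (a * (T - y)) * Real.log ‖X + y * I - w‖) volume p q :=
      fun p q => IntervalIntegrable.continuousOn_mul
        (intervalIntegrable_log_norm_line w X I p q) hs.continuousOn
    have al := integral_add_adjacent_intervals (hl 0 w.im) (hl w.im T)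
    have ar := integral_add_adjacent_intervals (hr 0 w.im) (hr w.im T)
    have hk : 2 * Real.pi * stripKernel a T X w = -Real.sinh (a * (T - w.im)) * Real.pi *
        if 0 ≤ w.re ∧ w.re ≤ X then -2 * Real.sin (a * w.re) else 0 := by
      rw [stripKernel, abs_of_nonneg hw]
      by_cases h' : 0 ≤ w.re ∧ w.re ≤ X
      · rw [if_pos ⟨h', h⟩, if_pos h']
        ring
      · rw [if_neg (fun h'' => h' h''.1), if_neg h']
        ring
    rw [hk, ← ej]
    unfold halfStripFunctional
    rw [← al, ← ar]
    linarith

/-- The boundary functional of the rectangle `[0, X] × [-T, T]` with a source on the real axis. -/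
noncomputable def stripFunctional (a T X : ℝ) (u : ℂ → ℝ) : ℝ :=
  halfStripFunctional a T X u + halfStripFunctional a T X (fun z => u (conj z))

theorem stripKernel_conj (a T X : ℝ) (w : ℂ) : stripKernel a T X (conj w) = stripKernel a T X w := by
  simp [stripKernel]

theorem norm_conj_sub (z w : ℂ) : ‖conj z - w‖ = ‖z - conj w‖ := by
  rw [← Complex.norm_conj]
  simp

/-- Reflecting z amounts to replacing w by its conjugate. The branches used for the two points are
conjugate on the real axis, so the leftover integrals of the argument cancel. -/
theorem stripFunctional_log {a T X : ℝ} (hT : 0 ≤ T) (hX0 : 0 ≤ X)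
    (hX : Real.sin (a * X) = 0) (w : ℂ) :
    stripFunctional a T X (fun z => Real.log ‖z - w‖) = 2 * Real.pi * stripKernel a T X w := by
  have key : ∀ w : ℂ, 0 ≤ w.im → halfStripFunctional a T X (fun z => Real.log ‖z - w‖) +
      halfStripFunctional a T X (fun z => Real.log ‖z - conj w‖) =
      2 * Real.pi * stripKernel a T X w := by
    intro w hw
    rw [halfStripFunctional_log_of_im_nonneg hT hX0 hX hw,
      halfStripFunctional_log_of_im_nonpos hT hX0 hX (w := conj w) (by simpa using hw)]
    have : ∀ x : ℝ, (log (-I * (x - conj w))).im = -(log (I * (x - w))).im := by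
      intro x
      have h1 : -I * (x - conj w) = conj (I * (x - w)) := by simp
      rw [h1, log_conj, conj_im]
      -- `log_conj` needs an argument other than π, and here the real part of I(x - w) is Im w ≥ 0.
      intro h
      rw [arg_eq_pi_iff] at h
      simp at h
      linarith [h.1]
    simp only [this, mul_neg, intervalIntegral.integral_neg]
    ring
  unfold stripFunctional
  simp only [norm_conj_sub]
  rcases le_total 0 w.im with h | h
  · exact key w h
  · have := key (conj w) (by simpa using h)
    rw [conj_conj, stripKernel_conj] at this
    rw [add_comm]
    exact this

/-- Interval integrability along all segments. -/
def LineIntegrable (u : ℂ → ℝ) : Prop :=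
  ∀ (p q : ℂ) (α β : ℝ), IntervalIntegrable (fun t : ℝ => u (p + t * q)) volume α β

theorem LineIntegrable.conj {u : ℂ → ℝ} (hu : LineIntegrable u) :
    LineIntegrable (fun z => u (conj z)) := by
  intro p q α β
  simpa using hu (conj p) (conj q) α β

theorem LineIntegrable.const_mul {u : ℂ → ℝ} (hu : LineIntegrable u) (c : ℝ) :
    LineIntegrable (fun z => c * u z) := fun p q α β => (hu p q α β).const_mul c

theorem LineIntegrable.add {u v : ℂ → ℝ} (hu : LineIntegrable u) (hv : LineIntegrable v) :
    LineIntegrable (fun z => u z + v z) := fun p q α β => (hu p q α β).add (hv p q α β)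

theorem LineIntegrable.sum {ι : Type*} (s : Finset ι) {u : ι → ℂ → ℝ}
    (hu : ∀ i ∈ s, LineIntegrable (u i)) : LineIntegrable (fun z => ∑ i ∈ s, u i z) := by
  intro p q α β
  have := IntervalIntegrable.sum s (f := fun i (t : ℝ) => u i (p + t * q))
    (fun i hi => hu i hi p q α β)
  exact this.congr (by simp [Set.EqOn])

theorem LineIntegrable.edges {u : ℂ → ℝ} (hu : LineIntegrable u) (T X : ℝ) :
    IntervalIntegrable (fun y : ℝ => u (y * I)) volume 0 T ∧
    IntervalIntegrable (fun y : ℝ => u (X + y * I)) volume 0 T ∧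
    IntervalIntegrable (fun x : ℝ => u x) volume 0 X ∧
    IntervalIntegrable (fun x : ℝ => u (x + T * I)) volume 0 X := by
  refine ⟨?_, hu X I _ _, ?_, ?_⟩
  · simpa using hu 0 I 0 T
  · simpa using hu 0 1 0 X
  · simpa [add_comm] using hu (T * I) 1 0 X

theorem halfStripFunctional_add {a T X : ℝ} {u v : ℂ → ℝ} (hu : LineIntegrable u)
    (hv : LineIntegrable v) :
    halfStripFunctional a T X (fun z => u z + v z) =
      halfStripFunctional a T X u + halfStripFunctional a T X v := by
  obtain ⟨u1, u2, u3, u4⟩ := hu.edges T X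
  obtain ⟨v1, v2, v3, v4⟩ := hv.edges T X
  have hs : Continuous (fun y : ℝ => a * Real.sinh (a * (T - y))) := by fun_prop
  have hc : Continuous (fun x : ℝ => Real.sin (a * x)) := by fun_prop
  have hd : Continuous (fun x : ℝ => a * Real.sin (a * x)) := by fun_prop
  unfold halfStripFunctional
  simp only [mul_add]
  rw [intervalIntegral.integral_add (u1.continuousOn_mul hs.continuousOn)
      (v1.continuousOn_mul hs.continuousOn),
    intervalIntegral.integral_add (u2.continuousOn_mul hs.continuousOn)
      (v2.continuousOn_mul hs.continuousOn),
    intervalIntegral.integral_add (u3.continuousOn_mul hc.continuousOn)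
      (v3.continuousOn_mul hc.continuousOn),
    intervalIntegral.integral_add (u4.continuousOn_mul hd.continuousOn)
      (v4.continuousOn_mul hd.continuousOn)]
  ring

theorem halfStripFunctional_const_mul {a T X : ℝ} (c : ℝ) (u : ℂ → ℝ) :
    halfStripFunctional a T X (fun z => c * u z) = c * halfStripFunctional a T X u := by
  unfold halfStripFunctional
  simp only [mul_left_comm _ c, intervalIntegral.integral_const_mul]
  ring

theorem stripFunctional_add {a T X : ℝ} {u v : ℂ → ℝ} (hu : LineIntegrable u)
    (hv : LineIntegrable v) :
    stripFunctional a T X (fun z => u z + v z) =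
      stripFunctional a T X u + stripFunctional a T X v := by
  unfold stripFunctional
  rw [halfStripFunctional_add hu hv, halfStripFunctional_add hu.conj hv.conj]
  ring

theorem stripFunctional_const_mul {a T X : ℝ} (c : ℝ) (u : ℂ → ℝ) :
    stripFunctional a T X (fun z => c * u z) = c * stripFunctional a T X u := by
  unfold stripFunctional
  rw [halfStripFunctional_const_mul, halfStripFunctional_const_mul c (fun z => u (conj z))]
  ring

theorem stripFunctional_sum {a T X : ℝ} {ι : Type*} (s : Finset ι) {u : ι → ℂ → ℝ}
    (hu : ∀ i ∈ s, LineIntegrable (u i)) :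
    stripFunctional a T X (fun z => ∑ i ∈ s, u i z) = ∑ i ∈ s, stripFunctional a T X (u i) := by
  classical
  induction s using Finset.induction_on with
  | empty => simp [stripFunctional, halfStripFunctional]
  | insert i s hi ih =>
    simp only [Finset.sum_insert hi]
    rw [stripFunctional_add (hu i (Finset.mem_insert_self i s))
      (LineIntegrable.sum s fun j hj => hu j (Finset.mem_insert_of_mem hj)),
      ih fun j hj => hu j (Finset.mem_insert_of_mem hj)]

theorem ae_notMem_line {N : Set ℂ} (hN : N.Finite) (p : ℂ) {q : ℂ} (hq : q ≠ 0) :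
    ∀ᵐ t : ℝ, p + t * q ∉ N := by
  have : {t : ℝ | p + t * q ∈ N}.Finite := by
    refine hN.preimage (f := fun t : ℝ => p + t * q) ?_
    intro s _ t _ h
    have : (s : ℂ) * q = t * q := add_left_cancel h
    exact_mod_cast mul_right_cancel₀ hq this
  rw [ae_iff]
  simpa using this.measure_zero volume

theorem halfStripFunctional_congr {a T X : ℝ} (hT : 0 ≤ T) (hX : 0 ≤ X) {u v : ℂ → ℝ}
    {N : Set ℂ} (hN : N.Finite)
    (h : ∀ z, z ∉ N → z ∈ Icc 0 X ×ℂ Icc 0 T → u z = v z) :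
    halfStripFunctional a T X u = halfStripFunctional a T X v := by
  have n1 := ae_notMem_line hN 0 I_ne_zero
  have n2 := ae_notMem_line hN X I_ne_zero
  have n3 := ae_notMem_line hN 0 one_ne_zero
  have n4 := ae_notMem_line hN (T * I) one_ne_zero
  unfold halfStripFunctional
  congr 1
  · congr 1
    · congr 1
      · refine integral_congr_ae ?_
        filter_upwards [n1] with t ht htm
        rw [uIoc_of_le hT] at htm
        rw [zero_add] at ht
        rw [h _ ht]
        simp [mem_reProdIm, hX, htm.1.le, htm.2]
      · congr 1
        refine integral_congr_ae ?_
        filter_upwards [n2] with t ht htm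
        rw [uIoc_of_le hT] at htm
        rw [h _ ht]
        simp [mem_reProdIm, hX, htm.1.le, htm.2]
    · refine integral_congr_ae ?_
      filter_upwards [n4] with t ht htm
      rw [uIoc_of_le hX] at htm
      rw [mul_one, add_comm] at ht
      rw [h _ ht]
      simp [mem_reProdIm, hT, htm.1.le, htm.2]
  · congr 1
    refine integral_congr_ae ?_
    filter_upwards [n3] with t ht htm
    rw [uIoc_of_le hX] at htm
    rw [mul_one, zero_add] at ht
    rw [h _ ht]
    simp [mem_reProdIm, hT, htm.1.le, htm.2]

theorem stripFunctional_congr {a T X : ℝ} (hT : 0 ≤ T) (hX : 0 ≤ X) {u v : ℂ → ℝ}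
    {N : Set ℂ} (hN : N.Finite)
    (h : ∀ z, z ∉ N → z ∈ Icc 0 X ×ℂ Icc (-T) T → u z = v z) :
    stripFunctional a T X u = stripFunctional a T X v := by
  unfold stripFunctional
  rw [halfStripFunctional_congr hT hX hN fun z hz hzm => h z hz ?_,
    halfStripFunctional_congr hT hX (N := conj ⁻¹' N) (v := fun z => v (conj z)) ?_
      fun z hz hzm => h _ hz ?_]
  · refine hN.preimage ?_
    exact (starRingEnd ℂ).injective.injOn
  · simp only [mem_reProdIm, mem_Icc, conj_re, conj_im] at hzm ⊢
    exact ⟨hzm.1, by linarith [hzm.2.2], by linarith [hzm.2.1]⟩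
  · simp only [mem_reProdIm, mem_Icc] at hzm ⊢
    exact ⟨hzm.1, by linarith [hzm.2.1], hzm.2.2⟩

end StripFunctional

/-! ### Green's formula for log|f| with f meromorphic. -/

section MeromorphicGreen

open Complex Set Filter Topology MeasureTheory intervalIntegral ComplexConjugate InnerProductSpace
open scoped Interval

theorem halfStripFunctional_re_of_differentiableOn {a T X R : ℝ} (hT : 0 ≤ T) (hX0 : 0 ≤ X)
    (hX : Real.sin (a * X) = 0) {h : ℂ → ℂ} (hR : X + T < R)
    (hh : DifferentiableOn ℂ h (Metric.ball 0 R)) :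
    halfStripFunctional a T X (fun z => (h z).re) =
      a * Real.sinh (a * T) * ∫ x in (0 : ℝ)..X, Real.cos (a * x) * (h x).im := by
  have hsub : [[0, X]] ×ℂ [[0, T]] ⊆ Metric.ball (0 : ℂ) R := by
    intro z hz
    rw [uIcc_of_le hX0, uIcc_of_le hT, mem_reProdIm] at hz
    rw [mem_ball_zero_iff]
    refine (norm_le_abs_re_add_abs_im z).trans_lt ?_
    rw [abs_of_nonneg hz.1.1, abs_of_nonneg hz.2.1]
    linarith [hz.1.2, hz.2.2]
  have hc : ContinuousOn h ([[0, X]] ×ℂ [[0, T]]) := hh.continuousOn.mono hsub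
  refine halfStripFunctional_re hX (rectIntegralZero_of_differentiableOn ?_) ?_ ?_ ?_ ?_
  · refine DifferentiableOn.mul ?_ (hh.mono hsub)
    rw [show deriv (stripWeight a T) = _ from funext (deriv_stripWeight a T)]
    fun_prop
  all_goals
    refine ContinuousOn.intervalIntegrable (hc.comp (Continuous.continuousOn (by fun_prop)) ?_)
    intro t ht
    simp [mem_reProdIm, ht]

/-- The reflected function conj(h(conj z)) is again holomorphic, and its imaginary part on the real
axis is that of h with opposite sign. -/
theorem stripFunctional_re_of_differentiableOn {a T X R : ℝ} (hT : 0 ≤ T) (hX0 : 0 ≤ X)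
    (hX : Real.sin (a * X) = 0) {h : ℂ → ℂ} (hR : X + T < R)
    (hh : DifferentiableOn ℂ h (Metric.ball 0 R)) :
    stripFunctional a T X (fun z => (h z).re) = 0 := by
  have hh' : DifferentiableOn ℂ (fun z => conj (h (conj z))) (Metric.ball 0 R) := by
    intro z hz
    have : DifferentiableAt ℂ h (conj z) := by
      refine hh.differentiableAt (Metric.isOpen_ball.mem_nhds ?_)
      simpa using hz
    have h2 := this.conj_conj
    rw [conj_conj] at h2
    exact h2.differentiableWithinAt
  have e1 := halfStripFunctional_re_of_differentiableOn hT hX0 hX hR hh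
  have e2 := halfStripFunctional_re_of_differentiableOn hT hX0 hX hR hh'
  simp only [conj_re, conj_im, conj_ofReal, mul_neg, intervalIntegral.integral_neg] at e2
  unfold stripFunctional
  rw [e1, e2]
  ring

theorem lineIntegrable_log_norm {f : ℂ → ℂ} (hf : ∀ z, MeromorphicAt f z) :
    LineIntegrable (fun z => Real.log ‖f z‖) := by
  intro p q α β
  have : MeromorphicOn (fun t : ℝ => f (p + t * q)) [[α, β]] := by
    intro t _
    have h1 : AnalyticAt ℝ (fun t : ℝ => (t : ℂ)) t := ofRealCLM.analyticAt t
    have h2 : AnalyticAt ℝ (fun t : ℝ => p + t * q) t := by fun_prop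
    exact MeromorphicAt.comp_analyticAt (g := fun t : ℝ => p + t * q) (hf (p + t * q)) h2
  exact this.intervalIntegrable_log_norm

theorem mem_closedBall_of_stripKernel_ne_zero {a T X R : ℝ} (hR : X + T ≤ R) {w : ℂ}
    (hw : stripKernel a T X w ≠ 0) : w ∈ Metric.closedBall (0 : ℂ) R := by
  unfold stripKernel at hw
  split_ifs at hw with h
  · rw [mem_closedBall_zero_iff]
    refine (norm_le_abs_re_add_abs_im w).trans ?_
    rw [abs_of_nonneg h.1.1]
    linarith [h.1.2, h.2]
  · exact absurd rfl hw

/-- **Green's formula** on a rectangle for the logarithm of the modulus of a meromorphic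
function. -/
theorem stripFunctional_log_norm {a T X : ℝ} (hT : 0 ≤ T) (hX0 : 0 ≤ X)
    (hX : Real.sin (a * X) = 0) {f : ℂ → ℂ} (hf : ∀ z, MeromorphicAt f z)
    (hf' : ∀ z, meromorphicOrderAt f z ≠ ⊤) :
    stripFunctional a T X (fun z => Real.log ‖f z‖) =
      2 * Real.pi * ∑ᶠ w, ((meromorphicOrderAt f w).untop₀ : ℝ) * stripKernel a T X w := by
  -- The extra 1 keeps the closed rectangle inside the open ball.
  set R := X + T + 1 with hRdef
  set U := Metric.closedBall (0 : ℂ) R with hU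
  have hfU : MeromorphicOn f U := fun z _ => hf z
  have hcU : IsCompact U := isCompact_closedBall _ _
  set D := MeromorphicOn.divisor f U with hDdef
  have hD : (D : ℂ → ℤ).support.Finite := D.finiteSupport hcU
  -- Off a finite set log|f| is the sum of D(u) log|z - u| and log|g|. As g has no zeros, log|g| is
  -- the real part of a holomorphic function on the ball, which the functional annihilates.
  obtain ⟨g, hg, hg0, hfg⟩ := hfU.extract_zeros_poles (fun u => hf' u) hD
  have hlog := MeromorphicOn.extract_zeros_poles_log hg0 hfg
  have hN := hcU.finite_sdiff_of_mem_codiscreteWithin hlog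
  have hharm : HarmonicOnNhd (fun z => Real.log ‖g z‖) (Metric.ball 0 R) := fun z hz =>
    (hg z (Metric.ball_subset_closedBall hz)).harmonicAt_log_norm
      (hg0 ⟨z, Metric.ball_subset_closedBall hz⟩)
  obtain ⟨F, hF, hFg⟩ := hharm.exists_analyticOnNhd_ball_re_eq
  set S := hD.toFinset with hS
  have hsum : ∀ z, (∑ᶠ u, (fun z => (D u : ℝ) * Real.log ‖z - u‖)) z =
      ∑ u ∈ S, (D u : ℝ) * Real.log ‖z - u‖ := by
    intro z
    rw [finsum_eq_sum_of_support_subset (s := S), Finset.sum_apply]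
    intro u hu
    simp only [hS, Finite.coe_toFinset, Function.mem_support]
    intro h0
    apply hu
    ext z
    simp [h0]
  have hLf := lineIntegrable_log_norm hf
  have hLw : ∀ w : ℂ, LineIntegrable (fun z => Real.log ‖z - w‖) := fun w =>
    lineIntegrable_log_norm fun z => by fun_prop
  have hLS : LineIntegrable (fun z => ∑ u ∈ S, (D u : ℝ) * Real.log ‖z - u‖) :=
    LineIntegrable.sum S fun u _ => (hLw u).const_mul _
  have h0 : stripFunctional a T X (fun z => Real.log ‖f z‖ +
      (-1) * ∑ u ∈ S, (D u : ℝ) * Real.log ‖z - u‖) = 0 := by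
    rw [← stripFunctional_re_of_differentiableOn (R := R) hT hX0 hX (by linarith)
      hF.differentiableOn]
    refine stripFunctional_congr hT hX0 hN ?_
    intro z hzN hz
    have hzb : z ∈ Metric.ball (0 : ℂ) R := by
      rw [mem_ball_zero_iff]
      rw [mem_reProdIm] at hz
      refine (norm_le_abs_re_add_abs_im z).trans_lt ?_
      rw [abs_of_nonneg hz.1.1]
      have := abs_le.2 hz.2
      linarith [hz.1.2]
    have hzU := Metric.ball_subset_closedBall hzb
    have hz' : Real.log ‖f z‖ = (∑ᶠ u, (fun z => (D u : ℝ) * Real.log ‖z - u‖)) z +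
        Real.log ‖g z‖ := by
      by_contra hne
      exact hzN ⟨hzU, hne⟩
    rw [hz', hsum]
    have := hFg hzb
    simp only at this
    rw [this]
    ring
  rw [stripFunctional_add hLf (hLS.const_mul (-1)), stripFunctional_const_mul,
    stripFunctional_sum S fun u _ => (hLw u).const_mul _] at h0
  simp only [stripFunctional_const_mul, stripFunctional_log hT hX0 hX] at h0
  rw [finsum_eq_sum_of_support_subset (s := S), Finset.mul_sum]
  · have : ∀ w ∈ S, 2 * Real.pi * (((meromorphicOrderAt f w).untop₀ : ℝ) * stripKernel a T X w) =
        (D w : ℝ) * (2 * Real.pi * stripKernel a T X w) := by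
      intro w hw
      have hwU : w ∈ U := by
        apply D.supportWithinDomain
        simpa [hS] using hw
      rw [hDdef, MeromorphicOn.divisor_apply hfU hwU]
      ring
    rw [Finset.sum_congr rfl this]
    linarith
  · intro w hw
    simp only [Function.mem_support, ne_eq, mul_eq_zero, not_or] at hw
    have hwU : w ∈ U := mem_closedBall_of_stripKernel_ne_zero (by linarith) hw.2
    simp only [hS, Finite.coe_toFinset, Function.mem_support]
    rw [hDdef, MeromorphicOn.divisor_apply hfU hwU]
    exact_mod_cast hw.1

end MeromorphicGreen

/-! ### Pointwise bounds for log|ζ|. -/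

section ZetaBounds

open Complex Set Filter Topology MeasureTheory ComplexConjugate

theorem norm_Gamma_le_Gamma_re {z : ℂ} (hz : 0 < z.re) : ‖Gamma z‖ ≤ Real.Gamma z.re := by
  rw [Complex.Gamma_eq_integral hz, Real.Gamma_eq_integral hz, Complex.GammaIntegral]
  refine (norm_integral_le_integral_norm _).trans (le_of_eq ?_)
  refine setIntegral_congr_fun measurableSet_Ioi fun x hx => ?_
  have hx : 0 < x := hx
  simp only [norm_mul]
  rw [norm_cpow_eq_rpow_re_of_pos hx, norm_real, Real.norm_of_nonneg (Real.exp_pos _).le]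
  simp

theorem norm_sin_le_exp_abs_im (z : ℂ) : ‖sin z‖ ≤ Real.exp |z.im| := by
  have h1 : ‖exp (-z * I)‖ ≤ Real.exp |z.im| := by
    rw [norm_exp]
    apply Real.exp_le_exp.2
    simpa using le_abs_self z.im
  have h2 : ‖exp (z * I)‖ ≤ Real.exp |z.im| := by
    rw [norm_exp]
    apply Real.exp_le_exp.2
    simpa using neg_le_abs z.im
  rw [Complex.sin, norm_div, norm_mul, norm_I, mul_one]
  have h3 := norm_sub_le (exp (-z * I)) (exp (z * I))
  rw [RCLike.norm_ofNat]
  linarith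

theorem Gamma_le_one_of_mem_Icc {x : ℝ} (h1 : 1 ≤ x) (h2 : x ≤ 2) : Real.Gamma x ≤ 1 := by
  have := Real.convexOn_Gamma.le_max_of_mem_Icc (x := 1) (y := 2) (z := x)
    (by simp) (by simp) ⟨h1, h2⟩
  simpa [Real.Gamma_one, Real.Gamma_two] using this

/-- Reflection at z - 1 gives 1/Γ(z) = Γ(2 - z) sin(π(z - 1)) / (π(z - 1)), where 2 - z has real
part in [1, 2] and Γ ≤ 1 there. -/
theorem norm_inv_Gamma_le {z : ℂ} (h0 : 0 ≤ z.re) (h1 : z.re ≤ 1) (h2 : 1 / 2 ≤ |z.im|) :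
    ‖(Gamma z)⁻¹‖ ≤ 2 / Real.pi * Real.exp (Real.pi * |z.im|) := by
  have him : ∀ w : ℂ, w.im ≠ 0 → w ≠ 0 := fun w hw h => hw (by simp [h])
  have hzim : z.im ≠ 0 := by
    intro h
    rw [h] at h2
    norm_num at h2
  have hz1 : z - 1 ≠ 0 := him _ (by simpa using hzim)
  have hG : Gamma z = (z - 1) * Gamma (z - 1) := by
    have := Complex.Gamma_add_one (z - 1) hz1
    simpa using this
  have hR : Gamma (z - 1) * Gamma (2 - z) = Real.pi / sin (Real.pi * (z - 1)) := by
    have := Complex.Gamma_mul_Gamma_one_sub (z - 1)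
    rw [show 1 - (z - 1) = 2 - z by ring] at this
    exact this
  have hG2 : Gamma (2 - z) ≠ 0 := Complex.Gamma_ne_zero_of_re_pos (by simp; linarith)
  have hGz : Gamma (z - 1) ≠ 0 := by
    refine Complex.Gamma_ne_zero fun m hm => ?_
    have := congrArg im hm
    simp at this
    exact hzim this
  have hs : sin (Real.pi * (z - 1)) ≠ 0 := by
    intro h
    rw [h, div_zero] at hR
    exact (mul_ne_zero hGz hG2) hR
  have hpi : (Real.pi : ℂ) ≠ 0 := by exact_mod_cast Real.pi_ne_zero
  have e : (Gamma z)⁻¹ = (z - 1)⁻¹ * (Gamma (2 - z) * sin (Real.pi * (z - 1)) / Real.pi) := by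
    rw [hG]
    rw [eq_div_iff hs] at hR
    generalize sin (Real.pi * (z - 1)) = σ at hR hs ⊢
    field_simp
    linear_combination -hR
  have b1 : ‖(z - 1)⁻¹‖ ≤ 2 := by
    rw [norm_inv]
    have : 1 / 2 ≤ ‖z - 1‖ := by
      refine h2.trans ?_
      simpa using abs_im_le_norm (z - 1)
    rw [inv_le_comm₀ (by linarith) (by norm_num)]
    linarith
  have b2 : ‖Gamma (2 - z)‖ ≤ 1 := by
    refine (norm_Gamma_le_Gamma_re (by simp; linarith)).trans
      (Gamma_le_one_of_mem_Icc ?_ ?_) <;> simp <;> linarith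
  have b3 : ‖sin (Real.pi * (z - 1))‖ ≤ Real.exp (Real.pi * |z.im|) := by
    refine (norm_sin_le_exp_abs_im _).trans (le_of_eq ?_)
    rw [im_ofReal_mul, abs_mul, abs_of_pos Real.pi_pos]
    simp
  rw [e, norm_mul, norm_div, norm_mul, norm_real, Real.norm_of_nonneg Real.pi_pos.le]
  calc ‖(z - 1)⁻¹‖ * (‖Gamma (2 - z)‖ * ‖sin (Real.pi * (z - 1))‖ / Real.pi)
      ≤ 2 * (1 * Real.exp (Real.pi * |z.im|) / Real.pi) := by gcongr
    _ = _ := by ring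

/-- For 0 ≤ σ ≤ 1 the power t^(σ-1) is at most t^(-1) + 1. -/
theorem norm_mellin_le {f : ℝ → ℂ} (h0 : MellinConvergent f 0) (h1 : MellinConvergent f 1)
    {z : ℂ} (hz0 : 0 ≤ z.re) (hz1 : z.re ≤ 1) :
    ‖mellin f z‖ ≤ (∫ t in Ioi (0 : ℝ), ‖(t : ℂ) ^ ((0 : ℂ) - 1) • f t‖) +
      ∫ t in Ioi (0 : ℝ), ‖(t : ℂ) ^ ((1 : ℂ) - 1) • f t‖ := by
  have i0 : Integrable (fun t : ℝ => (t : ℂ) ^ ((0 : ℂ) - 1) • f t) (volume.restrict (Ioi 0)) := h0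
  have i1 : Integrable (fun t : ℝ => (t : ℂ) ^ ((1 : ℂ) - 1) • f t) (volume.restrict (Ioi 0)) := h1
  rw [← integral_add i0.norm i1.norm, mellin]
  refine norm_integral_le_of_norm_le (i0.norm.add i1.norm) ?_
  filter_upwards [ae_restrict_mem measurableSet_Ioi] with t ht
  have ht : 0 < t := ht
  rw [norm_smul, norm_smul, norm_smul, ← add_mul]
  refine mul_le_mul_of_nonneg_right ?_ (norm_nonneg _)
  rw [norm_cpow_eq_rpow_re_of_pos ht, norm_cpow_eq_rpow_re_of_pos ht,
    norm_cpow_eq_rpow_re_of_pos ht]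
  simp only [sub_re, zero_re, one_re]
  rcases le_total 1 t with h | h
  · exact (Real.rpow_le_rpow_of_exponent_le h (by linarith)).trans
      (le_add_of_nonneg_left (Real.rpow_nonneg ht.le _))
  · exact (Real.rpow_le_rpow_of_exponent_ge ht h (by linarith)).trans
      (le_add_of_nonneg_right (Real.rpow_nonneg ht.le _))

theorem exists_norm_completedRiemannZeta₀_le :
    ∃ M : ℝ, 0 ≤ M ∧ ∀ s : ℂ, 0 ≤ s.re → s.re ≤ 2 → ‖completedRiemannZeta₀ s‖ ≤ M := by
  set P := HurwitzZeta.hurwitzEvenFEPair 0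
  have hP := P.isStrongFEPair_toStrongFEPair
  have hm : ∀ z : ℂ, MellinConvergent P.f_modif z := fun z => (hP.hasMellin z).1
  refine ⟨((∫ t in Ioi (0 : ℝ), ‖(t : ℂ) ^ ((0 : ℂ) - 1) • P.f_modif t‖) +
      ∫ t in Ioi (0 : ℝ), ‖(t : ℂ) ^ ((1 : ℂ) - 1) • P.f_modif t‖) / 2, by positivity, ?_⟩
  intro s h0 h2
  have e : completedRiemannZeta₀ s = mellin P.f_modif (s / 2) / 2 := rfl
  rw [e, norm_div, RCLike.norm_ofNat]
  have hre : (s / 2).re = s.re / 2 := by simp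
  gcongr
  refine norm_mellin_le (hm 0) (hm 1) ?_ ?_ <;> rw [hre] <;> linarith

/-- For m ≥ 2 and σ = Re s one has m^(-σ) ≤ 2^(2-σ) m^(-2), and these m^(-2) sum to π²/6 - 1 < 0.66.
-/
theorem norm_riemannZeta_sub_one_le {s : ℂ} (hs : 2 ≤ s.re) :
    ‖riemannZeta s - 1‖ ≤ 66 / 100 * (2 : ℝ) ^ (2 - s.re) := by
  have hz : HasSum (fun n : ℕ => (1 : ℝ) / ((n : ℝ) + 2) ^ 2) (Real.pi ^ 2 / 6 - 1) := by
    have := (hasSum_nat_add_iff' 2).2 hasSum_zeta_two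
    simpa [Finset.sum_range_succ] using this
  have h1 : 1 < s.re := by linarith
  have hsum : Summable (fun n : ℕ => 1 / ((n : ℂ) + 1) ^ s) := by
    have := (summable_nat_add_iff 1).2 (Complex.summable_one_div_nat_cpow.2 h1)
    simpa using this
  have e : riemannZeta s - 1 = ∑' n : ℕ, 1 / ((n : ℂ) + 2) ^ s := by
    rw [zeta_eq_tsum_one_div_nat_add_one_cpow h1, hsum.tsum_eq_zero_add]
    simp only [Nat.cast_zero, zero_add, one_cpow, div_one, add_sub_cancel_left]
    congr 1
    ext n
    push_cast
    ring_nf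
  have hb : ∀ n : ℕ, ‖1 / ((n : ℂ) + 2) ^ s‖ ≤
      (2 : ℝ) ^ (2 - s.re) * ((1 : ℝ) / ((n : ℝ) + 2) ^ 2) := by
    intro n
    have hpos : (0 : ℝ) < n + 2 := by positivity
    have : ((n : ℂ) + 2) = (((n : ℝ) + 2 : ℝ) : ℂ) := by push_cast; rfl
    rw [norm_div, norm_one, this, norm_cpow_eq_rpow_re_of_pos hpos]
    have h3 : ((n : ℝ) + 2) ^ s.re = ((n : ℝ) + 2) ^ (s.re - 2) * ((n : ℝ) + 2) ^ 2 := by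
      rw [← Real.rpow_natCast, ← Real.rpow_add hpos]
      norm_num
    have h4 : (2 : ℝ) ^ (s.re - 2) ≤ ((n : ℝ) + 2) ^ (s.re - 2) :=
      Real.rpow_le_rpow (by norm_num) (by linarith [n.cast_nonneg (α := ℝ)]) (by linarith)
    have h5 : (2 : ℝ) ^ (2 - s.re) = ((2 : ℝ) ^ (s.re - 2))⁻¹ := by
      rw [← Real.rpow_neg (by norm_num), neg_sub]
    have h6 : (0 : ℝ) < 2 ^ (s.re - 2) := by positivity
    rw [h3, h5, one_div, one_div, mul_inv]
    gcongr
  rw [e]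
  refine (tsum_of_norm_bounded (hz.mul_left _) hb).trans ?_
  rw [mul_comm]
  gcongr
  have := Real.pi_lt_d2
  nlinarith [Real.pi_pos]

theorem abs_log_norm_le {z : ℂ} {d : ℝ} (hz : ‖z - 1‖ ≤ d) (hd : d ≤ 66 / 100) :
    |Real.log ‖z‖| ≤ 3 * d := by
  have h1 : ‖z‖ ≤ 1 + d := by
    have := norm_add_le (z - 1) 1
    simp only [sub_add_cancel, norm_one] at this
    linarith
  have h2 : 1 - d ≤ ‖z‖ := by
    have := norm_sub_norm_le 1 (1 - z)
    rw [norm_one, sub_sub_cancel, norm_sub_rev] at this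
    linarith
  have hpos : 0 < ‖z‖ := by linarith
  have hd0 : 0 ≤ d := (norm_nonneg _).trans hz
  rw [abs_le]
  constructor
  · have h3 := Real.one_sub_inv_le_log_of_pos hpos
    have h4 : ‖z‖⁻¹ ≤ (1 - d)⁻¹ := inv_anti₀ (by linarith) h2
    -- This amounts to d(2 - 3d) ≥ 0, hence the threshold 0.66 < 2/3.
    have h5 : (1 - d)⁻¹ ≤ 1 + 3 * d := by
      rw [inv_le_iff_one_le_mul₀ (by linarith)]
      nlinarith
    linarith
  · have := Real.log_le_sub_one_of_pos hpos
    linarith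

theorem abs_log_norm_riemannZeta_le {s : ℂ} (hs : 2 ≤ s.re) :
    |Real.log ‖riemannZeta s‖| ≤ 8 * Real.exp (-(s.re / 2)) := by
  have h1 := norm_riemannZeta_sub_one_le hs
  have h2 : (2 : ℝ) ^ (2 - s.re) ≤ 1 :=
    Real.rpow_le_one_of_one_le_of_nonpos (by norm_num) (by linarith)
  refine (abs_log_norm_le h1 (by linarith)).trans ?_
  -- The constant is 3 · 0.66 · 4 = 7.92 < 8, and log 2 > 1/2 gives the rate.
  have h3 : (2 : ℝ) ^ (2 - s.re) = 4 * (2 : ℝ) ^ (-s.re) := by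
    rw [sub_eq_add_neg, Real.rpow_add (by norm_num)]
    norm_num
  have h4 : (2 : ℝ) ^ (-s.re) ≤ Real.exp (-(s.re / 2)) := by
    rw [Real.rpow_def_of_pos (by norm_num)]
    apply Real.exp_le_exp.2
    nlinarith [Real.log_two_gt_d9]
  rw [h3]
  have := Real.exp_pos (-(s.re / 2))
  linarith

/-- For 0 ≤ Re s ≤ 2 the completed function is bounded once |Im s| ≥ 1, and dividing by Γ(s/2) costs
at most an exponential of |Im s|. No pointwise lower bound is possible near zeros. -/
theorem exists_log_norm_riemannZeta_le :
    ∃ K : ℝ, 8 ≤ K ∧ ∀ s : ℂ, 0 ≤ s.re → 1 ≤ |s.im| →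
      Real.log ‖riemannZeta s‖ ≤ K * (1 + |s.im|) := by
  obtain ⟨M, hM0, hM⟩ := exists_norm_completedRiemannZeta₀_le
  refine ⟨8 + 2 * (M + 2), by linarith, fun s hs0 him => ?_⟩
  rcases le_total 2 s.re with h2 | h2
  · have h3 := abs_log_norm_riemannZeta_le h2
    have h4 : Real.exp (-(s.re / 2)) ≤ 1 := Real.exp_le_one_iff.2 (by linarith)
    have := le_abs_self (Real.log ‖riemannZeta s‖)
    nlinarith [abs_nonneg s.im]
  · have hne : s ≠ 0 := by
      rintro rfl
      norm_num at him
    have b0 := hM s hs0 h2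
    have b1 : ‖1 / s‖ ≤ 1 := by
      rw [norm_div, norm_one]
      exact div_le_one_of_le₀ (him.trans (abs_im_le_norm s)) (norm_nonneg _)
    have b2 : ‖1 / (1 - s)‖ ≤ 1 := by
      rw [norm_div, norm_one]
      refine div_le_one_of_le₀ (him.trans ?_) (norm_nonneg _)
      simpa using abs_im_le_norm (1 - s)
    have b3 : ‖((Real.pi : ℂ) ^ (-s / 2))⁻¹‖ ≤ Real.pi := by
      rw [← cpow_neg, norm_cpow_eq_rpow_re_of_pos Real.pi_pos]
      calc Real.pi ^ (-(-s / 2)).re ≤ Real.pi ^ (1 : ℝ) :=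
            Real.rpow_le_rpow_of_exponent_le (by linarith [Real.pi_gt_three]) (by simp; linarith)
        _ = Real.pi := Real.rpow_one _
    have b4 : ‖(Gamma (s / 2))⁻¹‖ ≤ 2 / Real.pi * Real.exp (Real.pi * |(s / 2).im|) := by
      have hre : (s / 2).re = s.re / 2 := by simp
      have him' : (s / 2).im = s.im / 2 := by simp
      refine norm_inv_Gamma_le ?_ ?_ ?_
      · rw [hre]; linarith
      · rw [hre]; linarith
      · rw [him', abs_div, abs_two]; linarith
    have b5 : ‖completedRiemannZeta₀ s - 1 / s - 1 / (1 - s)‖ ≤ M + 2 := by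
      refine (norm_sub_le _ _).trans ?_
      have := norm_sub_le (completedRiemannZeta₀ s) (1 / s)
      linarith
    have hb : ‖riemannZeta s‖ ≤ 2 * (M + 2) * Real.exp (2 * |s.im|) := by
      rw [riemannZeta_eq_completedRiemannZeta₀ hne, div_eq_mul_inv, mul_inv, norm_mul, norm_mul]
      calc _ ≤ (M + 2) * (Real.pi * (2 / Real.pi * Real.exp (Real.pi * |(s / 2).im|))) := by
            gcongr
        _ = 2 * (M + 2) * Real.exp (Real.pi * |(s / 2).im|) := by
            field_simp
        _ ≤ _ := by
            have : |(s / 2).im| = |s.im| / 2 := by simp [abs_div]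
            rw [this]
            refine mul_le_mul_of_nonneg_left (Real.exp_le_exp.2 ?_) (by linarith)
            nlinarith [Real.pi_lt_four, abs_nonneg s.im]
    rcases eq_or_ne (riemannZeta s) 0 with h0 | h0
    · rw [h0, norm_zero, Real.log_zero]
      positivity
    · have h3 := Real.log_le_log (norm_pos_iff.2 h0) hb
      rw [Real.log_mul (by positivity) (Real.exp_pos _).ne', Real.log_exp] at h3
      have h4 := Real.log_le_sub_one_of_pos (show 0 < 2 * (M + 2) by linarith)
      nlinarith [abs_nonneg s.im]

end ZetaBounds

/-! ### Linear growth of integrals of |log|ζ|| over vertical and horizontal segments. -/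

section LineBounds

open Complex Set Filter Topology MeasureTheory intervalIntegral ComplexConjugate
open scoped Interval

theorem riemannZeta_eq_zpow_mul {s : ℂ} (hs : s ≠ 1) :
    riemannZeta s = (s - 1) ^ (-1 : ℤ) * riemannZeta₁ s := by
  rw [riemannZeta_eq_inv_sub_mul hs, zpow_neg_one]

theorem riemannZeta_eventuallyEq_zpow_mul :
    riemannZeta =ᶠ[𝓝[≠] 1] fun s => (s - 1) ^ (-1 : ℤ) • riemannZeta₁ s := by
  filter_upwards [self_mem_nhdsWithin] with s hs
  exact riemannZeta_eq_zpow_mul hs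

theorem analyticAt_riemannZeta {s : ℂ} (hs : s ≠ 1) : AnalyticAt ℂ riemannZeta s :=
  analyticOn_riemannZeta s hs

theorem analyticAt_riemannZeta₁ (s : ℂ) : AnalyticAt ℂ riemannZeta₁ s :=
  differentiable_riemannZeta₁.analyticAt s

theorem meromorphicAt_riemannZeta (s : ℂ) : MeromorphicAt riemannZeta s := by
  rcases eq_or_ne s 1 with rfl | hs
  · have h1 := analyticAt_riemannZeta₁ 1
    refine MeromorphicAt.congr (f := fun s : ℂ => (s - 1) ^ (-1 : ℤ) • riemannZeta₁ s) ?_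
      riemannZeta_eventuallyEq_zpow_mul.symm
    exact MeromorphicAt.smul (f := fun s : ℂ => (s - 1) ^ (-1 : ℤ)) (by fun_prop) h1.meromorphicAt
  · exact (analyticAt_riemannZeta hs).meromorphicAt

theorem meromorphicOrderAt_riemannZeta_one : meromorphicOrderAt riemannZeta 1 = (-1 : ℤ) := by
  rw [meromorphicOrderAt_eq_int_iff (meromorphicAt_riemannZeta 1)]
  exact ⟨riemannZeta₁, analyticAt_riemannZeta₁ 1, by simp [riemannZeta₁_one],
    riemannZeta_eventuallyEq_zpow_mul⟩

theorem meromorphicOrderAt_riemannZeta_ne_top (s : ℂ) : meromorphicOrderAt riemannZeta s ≠ ⊤ := by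
  rcases eq_or_ne s 1 with rfl | hs
  · rw [meromorphicOrderAt_riemannZeta_one]
    exact WithTop.coe_ne_top
  · rw [meromorphicOrderAt_ne_top_iff_eventually_ne_zero (meromorphicAt_riemannZeta s)]
    by_contra h
    have hfreq : ∃ᶠ z in 𝓝[≠] s, riemannZeta z = 0 := h
    have h2 := analyticOn_riemannZeta.eqOn_zero_of_preconnected_of_frequently_eq_zero
      (isConnected_compl_singleton_of_one_lt_rank (by simp) 1).isPreconnected hs hfreq
    have := h2 (x := 2) (by simp)
    exact riemannZeta_ne_zero_of_one_le_re (s := 2) (by simp) this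

theorem meromorphicOrderAt_riemannZeta_nonneg {s : ℂ} (hs : s ≠ 1) :
    0 ≤ (meromorphicOrderAt riemannZeta s).untop₀ := by
  have h := (analyticAt_riemannZeta hs).meromorphicOrderAt_nonneg
  have h2 := WithTop.coe_untop₀_of_ne_top (meromorphicOrderAt_riemannZeta_ne_top s)
  rw [← h2] at h
  exact_mod_cast h

theorem lineIntegrable_const (M : ℝ) : LineIntegrable (fun _ => M) := fun _ _ _ _ =>
  _root_.intervalIntegrable_const

theorem stripFunctional_const {a T X : ℝ} (hT : 0 ≤ T) (hX0 : 0 ≤ X)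
    (hX : Real.sin (a * X) = 0) (M : ℝ) : stripFunctional a T X (fun _ => M) = 0 := by
  have := stripFunctional_re_of_differentiableOn (R := X + T + 1) (h := fun _ => (M : ℂ)) hT hX0 hX
    (by linarith) (differentiableOn_const _)
  simpa using this

/-- With a = 1 and X = π, where -cos π = 1, every edge term is nonnegative, so each is bounded by
the source term 2 cosh T ∫ sin x v(x) dx ≤ 4 cosh T · B. -/
theorem integral_edges_le_of_stripFunctional_nonpos {T B : ℝ} (hT : 0 ≤ T) {v : ℂ → ℝ}
    (hv : LineIntegrable v) (h0 : ∀ z ∈ Icc 0 Real.pi ×ℂ Icc (-T) T, 0 ≤ v z)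
    (hB : ∀ x : ℝ, x ∈ Icc 0 Real.pi → v x ≤ B) (hs : stripFunctional 1 T Real.pi v ≤ 0) :
    (∫ y in (0 : ℝ)..T, Real.sinh (T - y) * v (y * I)) ≤ 4 * Real.cosh T * B ∧
    (∫ x in (0 : ℝ)..Real.pi, Real.sin x * v (x + T * I)) ≤ 4 * Real.cosh T * B := by
  have hpi := Real.pi_pos.le
  have nn : ∀ v : ℂ → ℝ, (∀ z ∈ Icc 0 Real.pi ×ℂ Icc 0 T, 0 ≤ v z) →
      0 ≤ (∫ y in (0 : ℝ)..T, Real.sinh (T - y) * v (y * I)) ∧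
      0 ≤ (∫ y in (0 : ℝ)..T, Real.sinh (T - y) * v (Real.pi + y * I)) ∧
      0 ≤ (∫ x in (0 : ℝ)..Real.pi, Real.sin x * v (x + T * I)) := by
    intro v h0
    refine ⟨integral_nonneg hT fun y hy => ?_, integral_nonneg hT fun y hy => ?_,
      integral_nonneg hpi fun x hx => ?_⟩
    · exact mul_nonneg (Real.sinh_nonneg_iff.2 (by linarith [hy.2]))
        (h0 _ (by simp [mem_reProdIm, hy.1, hy.2, hpi]))
    · exact mul_nonneg (Real.sinh_nonneg_iff.2 (by linarith [hy.2]))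
        (h0 _ (by simp [mem_reProdIm, hy.1, hy.2, hpi]))
    · exact mul_nonneg (Real.sin_nonneg_of_mem_Icc hx)
        (h0 _ (by simp [mem_reProdIm, hx.1, hx.2, hT]))
  obtain ⟨a1, a2, a3⟩ := nn v fun z hz => h0 z ⟨hz.1, by
    have := hz.2
    simp only [mem_preimage, mem_Icc] at this ⊢
    exact ⟨by linarith, this.2⟩⟩
  obtain ⟨b1, b2, b3⟩ := nn (fun z => v (conj z)) fun z hz => h0 _ ⟨by simpa using hz.1, by
    have := hz.2
    simp only [mem_preimage, mem_Icc, conj_im] at this ⊢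
    exact ⟨by linarith, by linarith⟩⟩
  have hin : (∫ x in (0 : ℝ)..Real.pi, Real.sin x * v x) ≤ 2 * B := by
    have h1 : (∫ x in (0 : ℝ)..Real.pi, Real.sin x * B) = 2 * B := by
      rw [intervalIntegral.integral_mul_const, integral_sin, Real.cos_zero, Real.cos_pi]
      ring
    rw [← h1]
    refine integral_mono_on hpi ((hv.edges T Real.pi).2.2.1.continuousOn_mul
      Real.continuous_sin.continuousOn) (Continuous.intervalIntegrable (by fun_prop) _ _) ?_
    intro x hx
    exact mul_le_mul_of_nonneg_left (hB x hx) (Real.sin_nonneg_of_mem_Icc hx)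
  have hc := Real.cosh_pos T
  have hin2 := mul_le_mul_of_nonneg_left hin hc.le
  unfold stripFunctional halfStripFunctional at hs
  simp only [one_mul, Real.cos_pi, conj_ofReal] at hs
  constructor <;> linarith

/-- The boundary integrals of `|log |ζ||` over a rectangle with right half in `Re s ≥ 3`. -/
theorem integral_log_riemannZeta_edges_le {K : ℝ} (hK8 : 8 ≤ K)
    (hK : ∀ s : ℂ, 0 ≤ s.re → 1 ≤ |s.im| → Real.log ‖riemannZeta s‖ ≤ K * (1 + |s.im|))
    {T t M : ℝ} (hT : 0 ≤ T) (hT3 : T ≤ 3) (ht : 1 ≤ t) (hM : M = K * (5 + t)) :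
    (∫ y in (0 : ℝ)..T, Real.sinh (T - y) *
      (M - Real.log ‖riemannZeta (3 + t * I + I * (y * I))‖)) ≤ 8 * Real.cosh T * M ∧
    (∫ x in (0 : ℝ)..Real.pi, Real.sin x *
      (M - Real.log ‖riemannZeta (3 + t * I + I * (x + T * I))‖)) ≤ 8 * Real.cosh T * M := by
  -- The point x + iy goes to 3 - y + i(t + x). The real segment lands on Re s = 3, where log|ζ| is
  -- bounded, and T ≤ 3 keeps Re s ≥ 0.
  set f : ℂ → ℂ := fun z => riemannZeta (3 + t * I + I * z) with hf
  have hg : ∀ z : ℂ, AnalyticAt ℂ (fun z : ℂ => 3 + t * I + I * z) z := fun z => by fun_prop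
  have hg' : ∀ z : ℂ, deriv (fun z : ℂ => 3 + t * I + I * z) z ≠ 0 := fun z => by
    have : HasDerivAt (fun z : ℂ => 3 + t * I + I * z) I z := by
      simpa using ((hasDerivAt_id z).const_mul I).const_add (3 + t * I)
    rw [this.deriv]
    exact I_ne_zero
  have hfm : ∀ z, MeromorphicAt f z := fun z =>
    MeromorphicAt.comp_analyticAt (g := fun z : ℂ => 3 + t * I + I * z)
      (meromorphicAt_riemannZeta _) (hg z)
  have hord : ∀ z, meromorphicOrderAt f z = meromorphicOrderAt riemannZeta (3 + t * I + I * z) :=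
    fun z => meromorphicOrderAt_comp_of_deriv_ne_zero (f := riemannZeta) (hg z) (hg' z)
  have hre : ∀ z : ℂ, (3 + t * I + I * z).re = 3 - z.im := fun z => by
    simp
    ring
  have him : ∀ z : ℂ, (3 + t * I + I * z).im = t + z.re := fun z => by simp
  have hL : LineIntegrable (fun z => Real.log ‖f z‖) := lineIntegrable_log_norm hfm
  have hX : Real.sin (1 * Real.pi) = 0 := by simp
  -- Subharmonicity: the image has Im s ≥ t ≥ 1, so it misses the pole, and the kernel is
  -- nonnegative.
  have hpos : 0 ≤ stripFunctional 1 T Real.pi (fun z => Real.log ‖f z‖) := by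
    rw [stripFunctional_log_norm hT Real.pi_pos.le hX hfm
      (fun z => by rw [hord]; exact meromorphicOrderAt_riemannZeta_ne_top _)]
    refine mul_nonneg (by positivity) (finsum_nonneg fun w => ?_)
    unfold stripKernel
    split_ifs with h
    · refine mul_nonneg ?_ (mul_nonneg ?_ ?_)
      · rw [hord]
        have h1 : (3 + t * I + I * w) ≠ 1 := by
          intro h2
          have := congrArg im h2
          rw [him] at this
          simp at this
          linarith [h.1.1]
        exact_mod_cast meromorphicOrderAt_riemannZeta_nonneg h1
      · rw [one_mul]
        exact Real.sin_nonneg_of_mem_Icc h.1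
      · rw [one_mul]
        exact Real.sinh_nonneg_iff.2 (by linarith [h.2])
    · simp
  have hLv : LineIntegrable (fun z => M + (-1) * Real.log ‖f z‖) :=
    (lineIntegrable_const M).add (hL.const_mul (-1))
  have hstrip : stripFunctional 1 T Real.pi (fun z => M + (-1) * Real.log ‖f z‖) ≤ 0 := by
    rw [stripFunctional_add (lineIntegrable_const M) (hL.const_mul (-1)),
      stripFunctional_const hT Real.pi_pos.le hX, stripFunctional_const_mul]
    linarith
  -- On Re s = 3 this gives M - log|ζ| ≤ M + 8 ≤ 2M. The 5 in M covers 1 + π.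
  have hM8 : 8 ≤ M := by rw [hM]; nlinarith
  have hmain := integral_edges_le_of_stripFunctional_nonpos (B := 2 * M) hT hLv ?_ ?_ hstrip
  · have e : ∀ z, M + (-1) * Real.log ‖f z‖ = M - Real.log ‖f z‖ := fun z => by ring
    simp only [e] at hmain
    refine ⟨hmain.1.trans (le_of_eq (by ring)), hmain.2.trans (le_of_eq (by ring))⟩
  · intro z hz
    simp only [mem_reProdIm, mem_Icc] at hz
    have h1 := hK (3 + t * I + I * z) (by rw [hre]; linarith [hz.2.2])
      (by rw [him, abs_of_nonneg] <;> linarith [hz.1.1])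
    rw [him, abs_of_nonneg (by linarith [hz.1.1])] at h1
    have h2 : K * (1 + (t + z.re)) ≤ M := by
      rw [hM]
      apply mul_le_mul_of_nonneg_left _ (by linarith)
      linarith [hz.1.2, Real.pi_lt_four]
    linarith
  · intro x hx
    have h1 := abs_log_norm_riemannZeta_le (s := 3 + t * I + I * x) (by rw [hre]; simp; norm_num)
    have h2 : Real.exp (-((3 + t * I + I * x : ℂ).re / 2)) ≤ 1 := by
      rw [hre]
      apply Real.exp_le_one_iff.2
      simp
      norm_num
    have h3 := (abs_le.1 h1).1
    linarith

/-- Height T = 3 - b puts the top edge on Re s = b. Starting at t - 1 places [t, t + 1] at x in [1,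
2], where the weight sin x is at least 1/2. -/
theorem exists_integral_abs_log_riemannZeta_vertical_le {b : ℝ} (hb : 0 < b) (hb3 : b ≤ 3) :
    ∃ C : ℝ, ∀ t : ℝ, 2 ≤ t →
      (∫ y in t..(t + 1), |Real.log ‖riemannZeta (b + I * y)‖|) ≤ C * (1 + t) := by
  obtain ⟨K, hK8, hK⟩ := exists_log_norm_riemannZeta_le
  refine ⟨(1 + 16 * Real.cosh (3 - b)) * (5 * K), fun t ht => ?_⟩
  obtain ⟨M, hM⟩ : ∃ M, M = K * (5 + (t - 1)) := ⟨_, rfl⟩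
  have hmain := (integral_log_riemannZeta_edges_le (T := 3 - b) (t := t - 1) hK8 hK
    (by linarith) (by linarith) (by linarith) hM).2
  set F : ℝ → ℝ := fun x => Real.log ‖riemannZeta (b + I * ((t - 1) + x : ℝ))‖ with hF
  have e : ∀ x : ℝ, Real.log ‖riemannZeta (3 + ((t - 1 : ℝ) : ℂ) * I +
      I * (x + ((3 - b : ℝ) : ℂ) * I))‖ = F x := by
    intro x
    simp only [hF]
    congr 3
    push_cast
    linear_combination (3 - (b : ℂ)) * I_mul_I
  simp only [e] at hmain
  have hFi : ∀ p q, IntervalIntegrable F volume p q := by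
    intro p q
    have := lineIntegrable_log_norm meromorphicAt_riemannZeta (b + I * (t - 1 : ℝ)) I p q
    refine this.congr ?_
    intro x _
    simp only [hF]
    congr 3
    push_cast
    ring
  have hM0 : 0 ≤ M := by rw [hM]; nlinarith
  have hFM : ∀ x, 0 ≤ x → x ≤ Real.pi → F x ≤ M := by
    intro x hx0 hx
    have him : ((b : ℂ) + I * ((t - 1) + x : ℝ)).im = (t - 1) + x := by simp
    have h1 := hK ((b : ℂ) + I * ((t - 1) + x : ℝ)) (by simp; linarith)
      (by rw [him, abs_of_nonneg] <;> linarith)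
    rw [him, abs_of_nonneg (by linarith)] at h1
    refine h1.trans ?_
    rw [hM]
    apply mul_le_mul_of_nonneg_left _ (by linarith)
    linarith [Real.pi_lt_four]
  have hpi := Real.pi_gt_three
  have hsub : (∫ x in (1 : ℝ)..2, Real.sin x * (M - F x)) ≤
      ∫ x in (0 : ℝ)..Real.pi, Real.sin x * (M - F x) := by
    refine integral_mono_interval (by norm_num) (by norm_num) (by linarith) ?_ ?_
    · filter_upwards [ae_restrict_mem measurableSet_Ioc] with x hx
      exact mul_nonneg (Real.sin_nonneg_of_mem_Icc ⟨hx.1.le, hx.2⟩)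
        (by linarith [hFM x hx.1.le hx.2])
    · exact ((_root_.intervalIntegrable_const).sub (hFi _ _)).continuousOn_mul
        Real.continuous_sin.continuousOn
  have hsin : ∀ x ∈ Icc (1 : ℝ) 2, 1 / 2 ≤ Real.sin x := by
    intro x hx
    have h1 : Real.pi / 6 ≤ x := by linarith [hx.1, Real.pi_lt_four]
    rw [← Real.sin_pi_div_six]
    rcases le_total x (Real.pi / 2) with h | h
    · exact Real.sin_le_sin_of_le_of_le_pi_div_two (by linarith) h h1
    · rw [← Real.sin_pi_sub x]
      refine Real.sin_le_sin_of_le_of_le_pi_div_two (by linarith) (by linarith) ?_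
      have := Real.pi_gt_d2
      linarith [hx.2]
  -- From F ≤ M follows |F| ≤ M + (M - F), and M - F ≤ 2 sin x (M - F).
  have hle : (∫ x in (1 : ℝ)..2, |F x|) ≤
      ∫ x in (1 : ℝ)..2, (M + 2 * (Real.sin x * (M - F x))) := by
    refine integral_mono_on (by norm_num) (hFi _ _).abs ?_ ?_
    · exact (_root_.intervalIntegrable_const).add
        ((((_root_.intervalIntegrable_const).sub (hFi _ _)).continuousOn_mul
          Real.continuous_sin.continuousOn).const_mul 2)
    · intro x hx
      have h1 := hFM x (by linarith [hx.1]) (by linarith [hx.2])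
      have h2 := hsin x hx
      rw [abs_le]
      constructor <;> nlinarith
  rw [intervalIntegral.integral_add (_root_.intervalIntegrable_const)
      ((((_root_.intervalIntegrable_const).sub (hFi _ _)).continuousOn_mul
          Real.continuous_sin.continuousOn).const_mul 2), intervalIntegral.integral_const_mul,
      intervalIntegral.integral_const] at hle
  have hshift : (∫ y in t..(t + 1), |Real.log ‖riemannZeta (b + I * y)‖|) =
      ∫ x in (1 : ℝ)..2, |F x| := by
    have := intervalIntegral.integral_comp_add_left
      (fun y : ℝ => |Real.log ‖riemannZeta (b + I * y)‖|) (a := 1) (b := 2) (t - 1)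
    rw [show t - 1 + 1 = t by ring, show t - 1 + 2 = t + 1 by ring] at this
    rw [← this]
  rw [hshift]
  have hc := Real.cosh_pos (3 - b)
  have hM5 : M ≤ 5 * K * (1 + t) := by rw [hM]; nlinarith
  calc (∫ x in (1 : ℝ)..2, |F x|) ≤ (1 + 16 * Real.cosh (3 - b)) * M := by
        norm_num at hle
        linarith
    _ ≤ (1 + 16 * Real.cosh (3 - b)) * (5 * K * (1 + t)) := by gcongr
    _ = _ := by ring

/-- The left edge of the turned rectangle is horizontal. With T = 3 its weight satisfies sinh(3 - y)
≥ 3 - y ≥ b on the part with Re s ≥ b. -/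
theorem exists_integral_abs_log_riemannZeta_horizontal_le {b : ℝ} (hb : 0 < b) (hb3 : b ≤ 3) :
    ∃ C : ℝ, ∀ t : ℝ, 1 ≤ t →
      (∫ x in (0 : ℝ)..(3 - b), |Real.log ‖riemannZeta (b + (x + t * I))‖|) ≤ C * (1 + t) := by
  obtain ⟨K, hK8, hK⟩ := exists_log_norm_riemannZeta_le
  refine ⟨(3 + 8 / b * Real.cosh 3) * (5 * K), fun t ht => ?_⟩
  obtain ⟨M, hM⟩ : ∃ M, M = K * (5 + t) := ⟨_, rfl⟩
  have hmain := (integral_log_riemannZeta_edges_le (T := 3) (t := t) hK8 hK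
    (by norm_num) le_rfl ht hM).1
  set F : ℝ → ℝ := fun y => Real.log ‖riemannZeta (3 - y + t * I)‖ with hF
  have e : ∀ y : ℝ, Real.log ‖riemannZeta (3 + t * I + I * (y * I))‖ = F y := by
    intro y
    simp only [hF]
    congr 3
    linear_combination (y : ℂ) * I_mul_I
  simp only [e] at hmain
  have hFi : ∀ p q, IntervalIntegrable F volume p q := by
    intro p q
    have := lineIntegrable_log_norm meromorphicAt_riemannZeta (3 + t * I) (-1) p q
    refine this.congr ?_
    intro x _
    simp only [hF]
    congr 3
    ring
  have hM0 : 0 ≤ M := by rw [hM]; nlinarith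
  have hFM : ∀ y, 0 ≤ y → y ≤ 3 → F y ≤ M := by
    intro y hy0 hy
    have him : ((3 : ℂ) - y + t * I).im = t := by simp
    have h1 := hK ((3 : ℂ) - y + t * I) (by simp; linarith)
      (by rw [him, abs_of_nonneg] <;> linarith)
    rw [him, abs_of_nonneg (by linarith)] at h1
    refine h1.trans ?_
    rw [hM]
    apply mul_le_mul_of_nonneg_left _ (by linarith)
    linarith
  have hsc : Continuous (fun y : ℝ => Real.sinh (3 - y)) := by fun_prop
  have hint : ∀ p q, IntervalIntegrable (fun y => Real.sinh (3 - y) * (M - F y)) volume p q :=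
    fun p q => ((_root_.intervalIntegrable_const).sub (hFi _ _)).continuousOn_mul hsc.continuousOn
  have hsub : (∫ y in (0 : ℝ)..(3 - b), Real.sinh (3 - y) * (M - F y)) ≤
      ∫ y in (0 : ℝ)..3, Real.sinh (3 - y) * (M - F y) := by
    refine integral_mono_interval le_rfl (by linarith) (by linarith) ?_ (hint _ _)
    filter_upwards [ae_restrict_mem measurableSet_Ioc] with y hy
    exact mul_nonneg (Real.sinh_nonneg_iff.2 (by linarith [hy.2]))
      (by linarith [hFM y hy.1.le hy.2])
  have hle : (∫ y in (0 : ℝ)..(3 - b), |F y|) ≤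
      ∫ y in (0 : ℝ)..(3 - b), (M + 1 / b * (Real.sinh (3 - y) * (M - F y))) := by
    refine integral_mono_on (by linarith) (hFi _ _).abs
      ((_root_.intervalIntegrable_const).add ((hint _ _).const_mul _)) ?_
    intro y hy
    have h1 := hFM y hy.1 (by linarith [hy.2])
    have h2 : b ≤ Real.sinh (3 - y) := by
      have : b ≤ 3 - y := by linarith [hy.2]
      exact this.trans (Real.self_le_sinh_iff.2 (by linarith))
    have h3 : M - F y ≤ 1 / b * (Real.sinh (3 - y) * (M - F y)) := by
      rw [← mul_assoc]
      refine le_mul_of_one_le_left (by linarith) ?_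
      rw [one_div, inv_mul_eq_div, le_div_iff₀ hb]
      linarith
    rw [abs_le]
    constructor <;> linarith
  rw [intervalIntegral.integral_add (_root_.intervalIntegrable_const)
      ((hint _ _).const_mul _), intervalIntegral.integral_const_mul,
      intervalIntegral.integral_const, smul_eq_mul] at hle
  have hshift : (∫ x in (0 : ℝ)..(3 - b), |Real.log ‖riemannZeta (b + (x + t * I))‖|) =
      ∫ y in (0 : ℝ)..(3 - b), |F y| := by
    have := intervalIntegral.integral_comp_sub_left (fun y : ℝ => |F y|)
      (a := 0) (b := 3 - b) (3 - b)
    rw [sub_self, sub_zero] at this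
    rw [← this]
    refine integral_congr fun x _ => ?_
    simp only [hF]
    congr 4
    push_cast
    ring
  rw [hshift]
  have hc := Real.cosh_pos 3
  have hM5 : M ≤ 5 * K * (1 + t) := by rw [hM]; nlinarith
  have h8 : 1 / b * (∫ y in (0 : ℝ)..(3 - b), Real.sinh (3 - y) * (M - F y)) ≤
      1 / b * (8 * Real.cosh 3 * M) := by
    gcongr
    exact hsub.trans hmain
  calc (∫ y in (0 : ℝ)..(3 - b), |F y|) ≤ (3 + 8 / b * Real.cosh 3) * M := by
        have : 1 / b * (8 * Real.cosh 3 * M) = 8 / b * Real.cosh 3 * M := by ring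
        nlinarith
    _ ≤ (3 + 8 / b * Real.cosh 3) * (5 * K * (1 + t)) := by gcongr
    _ = _ := by ring

end LineBounds

/-! ### Integrability on the half line and limits of hyperbolic quotients. -/

section ZetaIntegrals

open Complex Set Filter Topology MeasureTheory intervalIntegral ComplexConjugate
open scoped Interval

theorem intervalIntegrable_log_riemannZeta_vertical (b p q : ℝ) :
    IntervalIntegrable (fun t : ℝ => Real.log ‖riemannZeta (b + I * t)‖) volume p q := by
  simpa [mul_comm] using lineIntegrable_log_norm meromorphicAt_riemannZeta b I p q

theorem intervalIntegrable_log_riemannZeta_real (b p q : ℝ) :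
    IntervalIntegrable (fun x : ℝ => Real.log ‖riemannZeta (b + x)‖) volume p q := by
  simpa using lineIntegrable_log_norm meromorphicAt_riemannZeta b 1 p q

/-- On [k, k + 1] with k ≥ 2 the integral is O((1 + k) exp(-ak)), which is summable. -/
theorem integrableOn_exp_mul_log_riemannZeta {a b : ℝ} (ha : 0 < a) (hb : 0 < b) (hb3 : b ≤ 3) :
    IntegrableOn (fun t : ℝ => Real.exp (-(a * t)) * Real.log ‖riemannZeta (b + I * t)‖)
      (Ioi 0) := by
  obtain ⟨C, hC⟩ := exists_integral_abs_log_riemannZeta_vertical_le hb hb3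
  set g : ℝ → ℝ := fun t => Real.exp (-(a * t)) * Real.log ‖riemannZeta (b + I * t)‖ with hg
  have hgi : ∀ p q, IntervalIntegrable g volume p q := fun p q =>
    (intervalIntegrable_log_riemannZeta_vertical b p q).continuousOn_mul
      (Continuous.continuousOn (by fun_prop))
  have hpos : ∀ k : ℕ, 0 ≤ ∫ t in (k : ℝ)..((k + 1 : ℕ) : ℝ), ‖g t‖ := fun k =>
    integral_nonneg (by push_cast; linarith) fun _ _ => norm_nonneg _
  have hk : ∀ k : ℕ, 2 ≤ k → (∫ t in (k : ℝ)..((k + 1 : ℕ) : ℝ), ‖g t‖) ≤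
      C * ((1 + k) * Real.exp (-a * k)) := by
    intro k hk2
    have h2 : (2 : ℝ) ≤ k := by exact_mod_cast hk2
    have h1 : (∫ t in (k : ℝ)..((k + 1 : ℕ) : ℝ), ‖g t‖) ≤
        ∫ t in (k : ℝ)..((k + 1 : ℕ) : ℝ),
          Real.exp (-a * k) * |Real.log ‖riemannZeta (b + I * t)‖| := by
      refine integral_mono_on (by push_cast; linarith) (hgi _ _).norm
        ((intervalIntegrable_log_riemannZeta_vertical b _ _).abs.const_mul _) ?_
      intro t ht
      rw [hg, norm_mul, Real.norm_eq_abs, Real.norm_eq_abs, abs_of_pos (Real.exp_pos _)]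
      refine mul_le_mul_of_nonneg_right (Real.exp_le_exp.2 ?_) (abs_nonneg _)
      nlinarith [ht.1]
    rw [intervalIntegral.integral_const_mul] at h1
    refine h1.trans ?_
    have h3 := mul_le_mul_of_nonneg_left (hC k h2) (Real.exp_pos (-a * k)).le
    push_cast
    refine h3.trans (le_of_eq (by ring))
  have hs : Summable (fun k : ℕ => C * ((1 + (k : ℝ)) * Real.exp (-a * k))) := by
    apply Summable.mul_left
    have h0 := Real.summable_pow_mul_exp_neg_nat_mul 0 ha
    have h1 := Real.summable_pow_mul_exp_neg_nat_mul 1 ha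
    refine (h0.add h1).congr fun k => ?_
    ring
  have hsum : Summable (fun k : ℕ => ∫ t in (k : ℝ)..((k + 1 : ℕ) : ℝ), ‖g t‖) := by
    refine Summable.of_norm_bounded_eventually_nat hs ?_
    filter_upwards [eventually_ge_atTop 2] with k hk2
    rw [Real.norm_of_nonneg (hpos k)]
    exact hk k hk2
  refine integrableOn_Ioi_of_intervalIntegral_norm_bounded (l := atTop) (b := fun n : ℕ => (n : ℝ))
    (∑' k : ℕ, ∫ t in (k : ℝ)..((k + 1 : ℕ) : ℝ), ‖g t‖) 0 (fun n => ?_)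
    tendsto_natCast_atTop_atTop (Eventually.of_forall fun n => ?_)
  · rw [← intervalIntegrable_iff_integrableOn_Ioc_of_le n.cast_nonneg]
    exact hgi _ _
  · have := sum_integral_adjacent_intervals (f := fun t => ‖g t‖) (μ := volume)
      (a := fun k : ℕ => (k : ℝ)) (n := n) (fun k _ => (hgi _ _).norm)
    rw [Nat.cast_zero] at this
    rw [← this]
    exact hsum.sum_le_tsum _ fun k _ => hpos k

theorem integrableOn_exp_neg_half (c : ℝ) :
    IntegrableOn (fun x : ℝ => 8 * Real.exp (-(x / 2))) (Ioi c) := by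
  have := (exp_neg_integrableOn_Ioi c (by norm_num : (0 : ℝ) < 1 / 2)).const_mul 8
  refine IntegrableOn.congr_fun this (fun x _ => ?_) measurableSet_Ioi
  congr 2
  ring

theorem abs_log_riemannZeta_add_le {b x : ℝ} (hb : 0 < b) (hx : 2 ≤ b + x) (y : ℝ) :
    |Real.log ‖riemannZeta (b + (x + y * I))‖| ≤ 8 * Real.exp (-(x / 2)) := by
  have hre : ((b : ℂ) + (x + y * I)).re = b + x := by simp
  refine (abs_log_norm_riemannZeta_le (by rw [hre]; exact hx)).trans ?_
  rw [hre]
  have : Real.exp (-((b + x) / 2)) ≤ Real.exp (-(x / 2)) := Real.exp_le_exp.2 (by linarith)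
  linarith

theorem integrableOn_sin_mul_log_riemannZeta (a : ℝ) {b : ℝ} (hb : 0 < b) :
    IntegrableOn (fun x : ℝ => Real.sin (a * x) * Real.log ‖riemannZeta (b + x)‖) (Ioi 0) := by
  have hi : ∀ p q, IntervalIntegrable
      (fun x : ℝ => Real.sin (a * x) * Real.log ‖riemannZeta (b + x)‖) volume p q := fun p q =>
    (intervalIntegrable_log_riemannZeta_real b p q).continuousOn_mul
      (Continuous.continuousOn (by fun_prop))
  have hloc : LocallyIntegrable
      (fun x : ℝ => Real.sin (a * x) * Real.log ‖riemannZeta (b + x)‖) := by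
    intro x
    refine ⟨Ioc (x - 1) (x + 1), Ioc_mem_nhds (by linarith) (by linarith), ?_⟩
    rw [← intervalIntegrable_iff_integrableOn_Ioc_of_le (by linarith)]
    exact hi _ _
  rw [← Ioc_union_Ioi_eq_Ioi (show (0 : ℝ) ≤ 2 by norm_num)]
  refine IntegrableOn.union ?_ ?_
  · rw [← intervalIntegrable_iff_integrableOn_Ioc_of_le (by norm_num)]
    exact hi _ _
  · refine Integrable.mono' (integrableOn_exp_neg_half 2) hloc.aestronglyMeasurable.restrict ?_
    filter_upwards [ae_restrict_mem measurableSet_Ioi] with x hx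
    have hx : 2 < x := hx
    have h1 := abs_log_riemannZeta_add_le hb (show 2 ≤ b + x by linarith) 0
    simp only [ofReal_zero, zero_mul, add_zero] at h1
    rw [norm_mul, Real.norm_eq_abs, Real.norm_eq_abs]
    calc _ ≤ 1 * |Real.log ‖riemannZeta (b + x)‖| := by
          gcongr
          exact Real.abs_sin_le_one _
      _ ≤ _ := by rw [one_mul]; exact h1

theorem sq_div_four_le_sinh {x : ℝ} (hx : 0 ≤ x) : x ^ 2 / 4 ≤ Real.sinh x := by
  have h1 := Real.quadratic_le_exp_of_nonneg hx
  have h2 : Real.exp (-x) ≤ 1 := Real.exp_le_one_iff.2 (by linarith)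
  rw [Real.sinh_eq]
  linarith

theorem tendsto_linear_div_sinh {a : ℝ} (ha : 0 < a) (c d : ℝ) :
    Tendsto (fun N : ℕ => (c + d * N) / Real.sinh (a * N)) atTop (𝓝 0) := by
  have h1 : Tendsto (fun N : ℕ => |c| * (4 / a ^ 2) * ((N : ℝ)⁻¹ * (N : ℝ)⁻¹) +
      |d| * (4 / a ^ 2) * (N : ℝ)⁻¹) atTop (𝓝 0) := by
    have h := tendsto_inv_atTop_nhds_zero_nat (𝕜 := ℝ)
    have := ((h.mul h).const_mul (|c| * (4 / a ^ 2))).add (h.const_mul (|d| * (4 / a ^ 2)))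
    simpa using this
  refine squeeze_zero_norm' ?_ h1
  filter_upwards [eventually_ge_atTop 1] with N hN
  have hN0 : (0 : ℝ) < N := by exact_mod_cast hN
  have h2 := sq_div_four_le_sinh (mul_pos ha hN0).le
  have h3 : 0 < (a * N) ^ 2 / 4 := by positivity
  have h4 : |c + d * N| ≤ |c| + |d| * N := by
    refine (abs_add_le _ _).trans ?_
    rw [abs_mul, abs_of_pos hN0]
  rw [norm_div, Real.norm_eq_abs, Real.norm_of_nonneg (h3.trans_le h2).le]
  calc _ ≤ (|c| + |d| * N) / ((a * N) ^ 2 / 4) := by gcongr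
    _ = _ := by field_simp

theorem tendsto_cosh_div_sinh {a : ℝ} (ha : 0 < a) :
    Tendsto (fun N : ℕ => Real.cosh (a * N) / Real.sinh (a * N)) atTop (𝓝 1) := by
  have h1 := tendsto_linear_div_sinh ha 1 0
  have h2 : Tendsto (fun N : ℕ => Real.exp (-(a * N)) / Real.sinh (a * N)) atTop (𝓝 0) := by
    refine squeeze_zero' ?_ ?_ h1
    · filter_upwards with N
      have : 0 ≤ Real.sinh (a * N) := Real.sinh_nonneg_iff.2 (by positivity)
      positivity
    · filter_upwards with N
      have : 0 ≤ Real.sinh (a * N) := Real.sinh_nonneg_iff.2 (by positivity)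
      have h3 : Real.exp (-(a * N)) ≤ 1 := Real.exp_le_one_iff.2 (by
        have : 0 ≤ a * N := by positivity
        linarith)
      rw [zero_mul, add_zero]
      gcongr
  have h3 := h2.const_add 1
  rw [add_zero] at h3
  refine h3.congr' ?_
  filter_upwards [eventually_ge_atTop 1] with N hN
  have hN0 : (0 : ℝ) < N := by exact_mod_cast hN
  have h4 : 0 < Real.sinh (a * N) := Real.sinh_pos_iff.2 (mul_pos ha hN0)
  rw [← Real.cosh_sub_sinh]
  field_simp
  ring

theorem sinh_sub_div_sinh_bounds {a y T : ℝ} (ha : 0 < a) (hy : 0 ≤ y) (hyT : y ≤ T) (hT : 0 < T) :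
    0 ≤ Real.sinh (a * (T - y)) / Real.sinh (a * T) ∧
      Real.sinh (a * (T - y)) / Real.sinh (a * T) ≤ Real.exp (-(a * y)) := by
  have h4 : 0 < Real.sinh (a * T) := Real.sinh_pos_iff.2 (mul_pos ha hT)
  refine ⟨div_nonneg (Real.sinh_nonneg_iff.2 (mul_nonneg ha.le (by linarith))) h4.le, ?_⟩
  rw [div_le_iff₀ h4, mul_sub, Real.sinh_sub, ← Real.cosh_sub_sinh]
  have h5 : Real.sinh (a * T) ≤ Real.cosh (a * T) := (Real.sinh_lt_cosh _).le
  have h6 : 0 ≤ Real.sinh (a * y) := Real.sinh_nonneg_iff.2 (mul_nonneg ha.le hy)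
  nlinarith

theorem sinh_sub_div_sinh {a y T : ℝ} (h : Real.sinh (a * T) ≠ 0) :
    Real.sinh (a * (T - y)) / Real.sinh (a * T) =
      Real.cosh (a * y) - Real.cosh (a * T) / Real.sinh (a * T) * Real.sinh (a * y) := by
  rw [mul_sub, Real.sinh_sub]
  field_simp

/-- Dominated convergence: the quotient tends to exp(-ay) and is bounded by it. -/
theorem tendsto_integral_sinh_ratio {a : ℝ} (ha : 0 < a) {u : ℝ → ℝ}
    (hu : IntegrableOn (fun t : ℝ => Real.exp (-(a * t)) * u t) (Ioi 0)) :
    Tendsto (fun N : ℕ => ∫ y in (0 : ℝ)..N, Real.sinh (a * (N - y)) / Real.sinh (a * N) * u y)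
      atTop (𝓝 (∫ t in Ioi (0 : ℝ), Real.exp (-(a * t)) * u t)) := by
  have hum : AEStronglyMeasurable u (volume.restrict (Ioi 0)) := by
    have h1 : AEStronglyMeasurable (fun t : ℝ => Real.exp (a * t)) (volume.restrict (Ioi 0)) :=
      (by fun_prop : Continuous fun t : ℝ => Real.exp (a * t)).aestronglyMeasurable
    refine (h1.mul hu.aestronglyMeasurable).congr (Eventually.of_forall fun t => ?_)
    simp only [Pi.mul_apply]
    rw [← mul_assoc, ← Real.exp_add]
    simp
  have e : ∀ N : ℕ, (∫ y in (0 : ℝ)..N, Real.sinh (a * (N - y)) / Real.sinh (a * N) * u y) =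
      ∫ y in Ioi (0 : ℝ), (Iic (N : ℝ)).indicator
        (fun y => Real.sinh (a * (N - y)) / Real.sinh (a * N) * u y) y := by
    intro N
    rw [integral_of_le N.cast_nonneg, setIntegral_indicator measurableSet_Iic, Ioi_inter_Iic]
  simp only [e]
  refine tendsto_integral_of_dominated_convergence
    (fun t => ‖Real.exp (-(a * t)) * u t‖) (fun N => ?_) hu.norm (fun N => ?_) ?_
  · refine AEStronglyMeasurable.indicator ?_ measurableSet_Iic
    refine AEStronglyMeasurable.mul ?_ hum
    exact (by fun_prop : Continuous fun y : ℝ =>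
      Real.sinh (a * (N - y)) / Real.sinh (a * N)).aestronglyMeasurable
  · filter_upwards [ae_restrict_mem measurableSet_Ioi] with y hy
    have hy : 0 < y := hy
    by_cases h : y ∈ Iic (N : ℝ)
    · rw [indicator_of_mem h, norm_mul, norm_mul]
      have hb := sinh_sub_div_sinh_bounds ha hy.le h (hy.trans_le h)
      refine mul_le_mul_of_nonneg_right ?_ (norm_nonneg _)
      rw [Real.norm_of_nonneg hb.1, Real.norm_of_nonneg (Real.exp_pos _).le]
      exact hb.2
    · rw [indicator_of_notMem h, norm_zero]
      exact norm_nonneg _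
  · filter_upwards [ae_restrict_mem measurableSet_Ioi] with y hy
    have hy : 0 < y := hy
    have h1 := (((tendsto_cosh_div_sinh ha).mul_const (Real.sinh (a * y))).const_sub
      (Real.cosh (a * y))).mul_const (u y)
    rw [one_mul, Real.cosh_sub_sinh] at h1
    refine h1.congr' ?_
    filter_upwards [tendsto_natCast_atTop_atTop.eventually_ge_atTop y] with N hN
    have hN : y ≤ N := hN
    have h4 : 0 < Real.sinh (a * N) := Real.sinh_pos_iff.2 (mul_pos ha (hy.trans_le hN))
    rw [indicator_of_mem (show y ∈ Iic (N : ℝ) from hN), sinh_sub_div_sinh h4.ne']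

theorem norm_riemannZeta_conj (s : ℂ) : ‖riemannZeta (conj s)‖ = ‖riemannZeta s‖ := by
  rw [riemannZeta_conj, Complex.norm_conj]

end ZetaIntegrals

/-! ### The limit of the boundary functional of log|ζ|. -/

section ZetaLimit

open Complex Set Filter Topology MeasureTheory intervalIntegral ComplexConjugate
open scoped Interval

theorem integral_sinh_eq_mul_integral_ratio {a T : ℝ} (h : Real.sinh (a * T) ≠ 0) (u : ℝ → ℝ) :
    (∫ y in (0 : ℝ)..T, a * Real.sinh (a * (T - y)) * u y) =
      a * Real.sinh (a * T) *
        ∫ y in (0 : ℝ)..T, Real.sinh (a * (T - y)) / Real.sinh (a * T) * u y := by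
  rw [← intervalIntegral.integral_const_mul]
  refine integral_congr fun y _ => ?_
  field_simp

/-- The quotient is at most 1 and |log|ζ|| decays exponentially in X = Nπ/a, against an edge of
length N. -/
theorem tendsto_right_edge {a b : ℝ} (ha : 0 < a) (hb : 0 < b) :
    Tendsto (fun N : ℕ => ∫ y in (0 : ℝ)..N, Real.sinh (a * (N - y)) / Real.sinh (a * N) *
      Real.log ‖riemannZeta (b + ((N * (Real.pi / a) : ℝ) + y * I))‖) atTop (𝓝 0) := by
  have h1 : Tendsto (fun N : ℕ => 8 * ((N : ℝ) ^ 1 * Real.exp (-(Real.pi / a / 2) * N)))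
      atTop (𝓝 0) := by
    have := (Real.summable_pow_mul_exp_neg_nat_mul 1
      (show 0 < Real.pi / a / 2 by positivity)).tendsto_atTop_zero.const_mul 8
    simpa using this
  refine squeeze_zero_norm' ?_ h1
  have hX : Tendsto (fun N : ℕ => (N : ℝ) * (Real.pi / a)) atTop atTop :=
    tendsto_natCast_atTop_atTop.atTop_mul_const (by positivity)
  filter_upwards [hX.eventually_ge_atTop 2, eventually_ge_atTop 1] with N hN hN1
  have hN0 : (0 : ℝ) < N := by exact_mod_cast hN1
  have hbd : ∀ y ∈ Ι (0 : ℝ) N, ‖Real.sinh (a * (N - y)) / Real.sinh (a * N) *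
      Real.log ‖riemannZeta (b + ((N * (Real.pi / a) : ℝ) + y * I))‖‖ ≤
      8 * Real.exp (-(N * (Real.pi / a) / 2)) := by
    intro y hy
    rw [uIoc_of_le hN0.le] at hy
    have hr := sinh_sub_div_sinh_bounds ha hy.1.le hy.2 hN0
    have hr1 : Real.exp (-(a * y)) ≤ 1 := Real.exp_le_one_iff.2 (by
      have := mul_pos ha hy.1
      linarith)
    have hz := abs_log_riemannZeta_add_le hb (x := N * (Real.pi / a)) (by linarith) y
    rw [norm_mul, Real.norm_of_nonneg hr.1, Real.norm_eq_abs]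
    calc _ ≤ 1 * (8 * Real.exp (-(N * (Real.pi / a) / 2))) := by
          gcongr
          exact hr.2.trans hr1
      _ = _ := one_mul _
  refine (norm_integral_le_of_norm_le_const hbd).trans (le_of_eq ?_)
  rw [sub_zero, abs_of_pos hN0, pow_one, mul_assoc, mul_comm (Real.exp _)]
  congr 3
  ring

/-- Split at Re s = 3: linear growth in N to the left, a bounded tail to the right, both beaten by
sinh(aN). -/
theorem tendsto_top_edge {a b : ℝ} (ha : 0 < a) (hb : 0 < b) (hb3 : b ≤ 3) :
    Tendsto (fun N : ℕ => (∫ x in (0 : ℝ)..(N * (Real.pi / a)), a * Real.sin (a * x) *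
      Real.log ‖riemannZeta (b + (x + (N : ℝ) * I))‖) / (a * Real.sinh (a * N))) atTop (𝓝 0) := by
  obtain ⟨C, hC⟩ := exists_integral_abs_log_riemannZeta_horizontal_le hb hb3
  set E : ℝ := ∫ x in Ioi (3 - b), 8 * Real.exp (-(x / 2)) with hE
  refine squeeze_zero_norm' ?_ (tendsto_linear_div_sinh ha (C + E) C)
  have hX : Tendsto (fun N : ℕ => (N : ℝ) * (Real.pi / a)) atTop atTop :=
    tendsto_natCast_atTop_atTop.atTop_mul_const (by positivity)
  filter_upwards [hX.eventually_ge_atTop 3, eventually_ge_atTop 1] with N hN hN1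
  have hN1' : (1 : ℝ) ≤ N := by exact_mod_cast hN1
  have hsp : 0 < Real.sinh (a * N) := Real.sinh_pos_iff.2 (mul_pos ha (by linarith))
  set X : ℝ := N * (Real.pi / a) with hXdef
  set u : ℝ → ℝ := fun x => Real.log ‖riemannZeta (b + (x + (N : ℝ) * I))‖ with hu
  have hui : ∀ p q, IntervalIntegrable u volume p q := by
    intro p q
    have := lineIntegrable_log_norm meromorphicAt_riemannZeta (b + (N : ℝ) * I) 1 p q
    refine this.congr ?_
    intro x _
    simp only [hu]
    congr 3
    ring
  have h1 : ‖∫ x in (0 : ℝ)..X, a * Real.sin (a * x) * u x‖ ≤ a * ∫ x in (0 : ℝ)..X, |u x| := by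
    rw [← intervalIntegral.integral_const_mul]
    refine norm_integral_le_of_norm_le (by linarith) ?_ ((hui _ _).abs.const_mul a)
    refine Eventually.of_forall fun x _ => ?_
    rw [norm_mul, norm_mul, Real.norm_of_nonneg ha.le, Real.norm_eq_abs, Real.norm_eq_abs]
    calc a * |Real.sin (a * x)| * |u x| ≤ a * 1 * |u x| := by
          gcongr
          exact Real.abs_sin_le_one _
      _ = a * |u x| := by ring
  have h2 : (∫ x in (3 - b)..X, |u x|) ≤ E := by
    have hle : 3 - b ≤ X := by linarith
    have h3 : (∫ x in (3 - b)..X, |u x|) ≤ ∫ x in (3 - b)..X, 8 * Real.exp (-(x / 2)) := by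
      refine integral_mono_on hle (hui _ _).abs (Continuous.intervalIntegrable (by fun_prop) _ _) ?_
      intro x hx
      exact abs_log_riemannZeta_add_le hb (by linarith [hx.1]) N
    refine h3.trans ?_
    rw [integral_of_le hle]
    refine setIntegral_mono_set (integrableOn_exp_neg_half _) ?_
      (LE.le.eventuallyLE Ioc_subset_Ioi_self)
    exact Eventually.of_forall fun x => by
      have := Real.exp_pos (-(x / 2))
      simp only [Pi.zero_apply]
      positivity
  have h4 := hC N hN1'
  have h5 := integral_add_adjacent_intervals (hui 0 (3 - b)).abs (hui (3 - b) X).abs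
  rw [norm_div, Real.norm_of_nonneg (mul_pos ha hsp).le]
  have h6 : (∫ x in (0 : ℝ)..X, |u x|) ≤ C + E + C * N := by
    rw [← h5]
    have : (∫ x in (0 : ℝ)..(3 - b), |u x|) ≤ C * (1 + N) := by simpa [hu] using h4
    linarith
  calc _ ≤ (a * (C + E + C * N)) / (a * Real.sinh (a * N)) := by
        gcongr
        exact h1.trans (mul_le_mul_of_nonneg_left h6 ha.le)
    _ = _ := mul_div_mul_left _ _ ha.ne'

theorem tendsto_stripFunctional_riemannZeta {a b : ℝ} (ha : 0 < a) (hb : 0 < b) (hb3 : b ≤ 3) :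
    Tendsto (fun N : ℕ => stripFunctional a N (N * (Real.pi / a))
      (fun z => Real.log ‖riemannZeta (b + z)‖) / (2 * a * Real.sinh (a * N))) atTop
      (𝓝 ((∫ t in Ioi (0 : ℝ), Real.exp (-(a * t)) * Real.log ‖riemannZeta (b + I * t)‖) -
        ∫ x in Ioi (0 : ℝ), Real.sin (a * x) * Real.log ‖riemannZeta (b + x)‖)) := by
  have t1 := tendsto_integral_sinh_ratio ha (integrableOn_exp_mul_log_riemannZeta ha hb hb3)
  have t2 := tendsto_right_edge ha hb
  have t3 := tendsto_top_edge ha hb hb3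
  have hX : Tendsto (fun N : ℕ => (N : ℝ) * (Real.pi / a)) atTop atTop :=
    tendsto_natCast_atTop_atTop.atTop_mul_const (by positivity)
  have t4 := intervalIntegral_tendsto_integral_Ioi 0 (integrableOn_sin_mul_log_riemannZeta a hb) hX
  have t5 := (tendsto_cosh_div_sinh ha).mul t4
  have t2' : Tendsto (fun N : ℕ => Real.cos (a * (N * (Real.pi / a))) *
      ∫ y in (0 : ℝ)..N, Real.sinh (a * (N - y)) / Real.sinh (a * N) *
      Real.log ‖riemannZeta (b + ((N * (Real.pi / a) : ℝ) + y * I))‖) atTop (𝓝 0) := by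
    have h := t2.norm
    rw [norm_zero] at h
    refine squeeze_zero_norm (fun N => ?_) h
    rw [norm_mul]
    exact mul_le_of_le_one_left (norm_nonneg _)
      (by rw [Real.norm_eq_abs]; exact Real.abs_cos_le_one _)
  have := ((t1.sub t2').add t3).sub t5
  rw [sub_zero, add_zero, one_mul] at this
  refine this.congr' ?_
  filter_upwards [eventually_ge_atTop 1] with N hN1
  have hN1' : (1 : ℝ) ≤ N := by exact_mod_cast hN1
  have hsp : 0 < Real.sinh (a * N) := Real.sinh_pos_iff.2 (mul_pos ha (by linarith))
  -- Conjugation symmetry makes the two half functionals equal, whence the 2 in the normalization.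
  have hsym : (fun z => Real.log ‖riemannZeta (b + conj z)‖) =
      fun z => Real.log ‖riemannZeta (b + z)‖ := by
    ext z
    rw [← norm_riemannZeta_conj (b + z)]
    simp
  have e1 : ∀ y : ℝ, (I * y : ℂ) = y * I := fun y => mul_comm _ _
  unfold stripFunctional
  simp only [hsym]
  unfold halfStripFunctional
  rw [integral_sinh_eq_mul_integral_ratio hsp.ne'
      (fun y => Real.log ‖riemannZeta (b + y * I)‖),
    integral_sinh_eq_mul_integral_ratio hsp.ne'
      (fun y => Real.log ‖riemannZeta (b + ((N * (Real.pi / a) : ℝ) + y * I))‖)]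
  simp only [e1]
  generalize (∫ y in (0 : ℝ)..N, Real.sinh (a * (N - y)) / Real.sinh (a * N) *
    Real.log ‖riemannZeta (b + y * I)‖) = J₁
  generalize (∫ y in (0 : ℝ)..N, Real.sinh (a * (N - y)) / Real.sinh (a * N) *
    Real.log ‖riemannZeta (b + ((N * (Real.pi / a) : ℝ) + y * I))‖) = J₂
  generalize (∫ x in (0 : ℝ)..(N * (Real.pi / a)), a * Real.sin (a * x) *
      Real.log ‖riemannZeta (b + (x + (N : ℝ) * I))‖) = J₃
  generalize (∫ x in (0 : ℝ)..(N * (Real.pi / a)), Real.sin (a * x) *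
      Real.log ‖riemannZeta (b + x)‖) = J₄
  generalize Real.cos (a * (N * (Real.pi / a))) = c
  field_simp
  ring

end ZetaLimit

/-! ### Orders of ζ and their invariance under s ↦ 1 - s. -/

section ZetaOrder

open Complex Set Filter Topology MeasureTheory ComplexConjugate

/-- The order of the Riemann zeta function at a point, as an integer. -/
noncomputable def zetaOrder (s : ℂ) : ℤ := (meromorphicOrderAt riemannZeta s).untop₀

theorem zetaOrder_one : zetaOrder 1 = -1 := by
  rw [zetaOrder, meromorphicOrderAt_riemannZeta_one]
  rfl

theorem zetaOrder_nonneg {s : ℂ} (hs : s ≠ 1) : 0 ≤ zetaOrder s :=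
  meromorphicOrderAt_riemannZeta_nonneg hs

theorem zetaOrder_eq_zero_iff {s : ℂ} (hs : s ≠ 1) : zetaOrder s = 0 ↔ riemannZeta s ≠ 0 := by
  rw [zetaOrder, ← (analyticAt_riemannZeta hs).meromorphicNFAt.meromorphicOrderAt_eq_zero_iff,
    WithTop.untop₀_eq_zero]
  simp [meromorphicOrderAt_riemannZeta_ne_top s]

theorem zetaOrder_pos {s : ℂ} (hs : s ≠ 1) (h : riemannZeta s = 0) : 0 < zetaOrder s :=
  lt_of_le_of_ne (zetaOrder_nonneg hs) fun h' => (zetaOrder_eq_zero_iff hs).1 h'.symm h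

theorem cos_pi_mul_div_two_eq_zero_iff {s : ℂ} :
    cos (Real.pi * s / 2) = 0 ↔ ∃ k : ℤ, s = 2 * k + 1 := by
  have hpi : (Real.pi : ℂ) ≠ 0 := ofReal_ne_zero.2 Real.pi_ne_zero
  rw [cos_eq_zero_iff]
  refine exists_congr fun k => ?_
  rw [div_left_inj' two_ne_zero, mul_comm, mul_left_inj' hpi]

theorem cos_pi_mul_div_two_ne_zero {s : ℂ} (h0 : 0 < s.re) (h1 : s.re < 1) :
    cos (Real.pi * s / 2) ≠ 0 := by
  rw [Ne, cos_pi_mul_div_two_eq_zero_iff]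
  rintro ⟨k, rfl⟩
  have e : (2 * (k : ℂ) + 1).re = ((2 * k + 1 : ℤ) : ℝ) := by simp
  rw [e] at h0 h1
  have h0' : 0 < 2 * k + 1 := by exact_mod_cast h0
  have h1' : 2 * k + 1 < 1 := by exact_mod_cast h1
  omega

/-- The factor c in the functional equation is analytic and nonzero in the open critical strip, the
zeros of its cosine being odd integers. -/
theorem zetaOrder_one_sub {s : ℂ} (h0 : 0 < s.re) (h1 : s.re < 1) :
    zetaOrder (1 - s) = zetaOrder s := by
  set c : ℂ → ℂ := fun z => 2 * (2 * Real.pi) ^ (-z) * Gamma z * cos (Real.pi * z / 2) with hc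
  have hopen : {z : ℂ | 0 < z.re ∧ z.re < 1} ∈ 𝓝 s :=
    ((isOpen_lt continuous_const continuous_re).inter
      (isOpen_lt continuous_re continuous_const)).mem_nhds ⟨h0, h1⟩
  have hpole : ∀ z : ℂ, 0 < z.re → ∀ n : ℕ, z ≠ -n := by
    rintro z hz n rfl
    simp only [neg_re, natCast_re, Left.neg_pos_iff] at hz
    exact absurd hz (not_lt.2 n.cast_nonneg)
  have h2pi : (2 * Real.pi : ℂ) ≠ 0 := by exact_mod_cast Real.two_pi_pos.ne'
  have hca : AnalyticAt ℂ c s := by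
    refine DifferentiableOn.analyticAt (s := {z : ℂ | 0 < z.re ∧ z.re < 1}) ?_ hopen
    intro z hz
    refine DifferentiableAt.differentiableWithinAt ?_
    have hg := differentiableAt_Gamma z (hpole z hz.1)
    refine (DifferentiableAt.mul (DifferentiableAt.mul (DifferentiableAt.const_mul ?_ _) hg) ?_)
    · exact differentiableAt_id.neg.const_cpow (Or.inl h2pi)
    · fun_prop
  have hc0 : c s ≠ 0 := by
    simp only [hc]
    refine mul_ne_zero (mul_ne_zero (mul_ne_zero two_ne_zero ?_) (Gamma_ne_zero (hpole s h0)))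
      (cos_pi_mul_div_two_ne_zero h0 h1)
    simp [cpow_eq_zero_iff, h2pi]
  have he : (riemannZeta ∘ fun z => 1 - z) =ᶠ[𝓝[≠] s] c * riemannZeta := by
    refine Filter.Eventually.filter_mono nhdsWithin_le_nhds ?_
    filter_upwards [hopen] with z hz
    refine riemannZeta_one_sub (hpole z hz.1) ?_
    rintro rfl
    simp at hz
  have hd : deriv (fun z : ℂ => 1 - z) s ≠ 0 := by simp
  have h := meromorphicOrderAt_congr he
  rw [meromorphicOrderAt_comp_of_deriv_ne_zero (by fun_prop) hd,
    meromorphicOrderAt_mul hca.meromorphicAt (meromorphicAt_riemannZeta s),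
    hca.meromorphicNFAt.meromorphicOrderAt_eq_zero_iff.2 hc0, zero_add] at h
  rw [zetaOrder, zetaOrder, h]

theorem stripFunctional_log_riemannZeta_add {a T X : ℝ} (hT : 0 ≤ T) (hX0 : 0 ≤ X)
    (hX : Real.sin (a * X) = 0) (b : ℂ) :
    stripFunctional a T X (fun z => Real.log ‖riemannZeta (b + z)‖) =
      2 * Real.pi * ∑ᶠ s, (zetaOrder s : ℝ) * stripKernel a T X (s - b) := by
  have ho : ∀ z, meromorphicOrderAt (fun z => riemannZeta (b + z)) z =
      meromorphicOrderAt riemannZeta (b + z) := by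
    intro z
    exact meromorphicOrderAt_comp_of_deriv_ne_zero (f := riemannZeta) (g := fun z => b + z)
      (by fun_prop) (by simp)
  have hm : ∀ z, MeromorphicAt (fun z => riemannZeta (b + z)) z := by
    intro z
    exact (meromorphicAt_riemannZeta (b + z)).comp_analyticAt (g := fun z => b + z) (by fun_prop)
  rw [stripFunctional_log_norm hT hX0 hX hm fun z => by
    rw [ho]; exact meromorphicOrderAt_riemannZeta_ne_top _]
  rw [← finsum_comp_equiv (Equiv.addLeft b)
    (f := fun s => (zetaOrder s : ℝ) * stripKernel a T X (s - b))]
  simp only [ho, Equiv.coe_addLeft, add_sub_cancel_left, zetaOrder]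

theorem hasFiniteSupport_zetaOrder_mul_stripKernel (a T X : ℝ) (b : ℂ) :
    (fun s => (zetaOrder s : ℝ) * stripKernel a T X (s - b)).HasFiniteSupport := by
  have hK : IsCompact (Metric.closedBall b (X + T)) := isCompact_closedBall _ _
  refine (hK.inter_riemannZetaZeros_finite.union (finite_singleton 1)).subset ?_
  intro s hs
  rw [Function.mem_support, mul_ne_zero_iff] at hs
  by_cases h1 : s = 1
  · exact Or.inr h1
  refine Or.inl ⟨?_, ?_⟩
  · have := mem_closedBall_of_stripKernel_ne_zero le_rfl hs.2
    simpa [dist_eq_norm] using this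
  · by_contra h
    exact hs.1 (by exact_mod_cast (zetaOrder_eq_zero_iff h1).2 h)

end ZetaOrder

/-! ### Cancellation and positivity in the sum over zeros. -/

section ZeroSum

open Complex Set Filter Topology MeasureTheory ComplexConjugate

theorem stripKernel_of_re_neg {a T X : ℝ} {w : ℂ} (h : w.re < 0) : stripKernel a T X w = 0 :=
  if_neg fun h' => absurd h'.1.1 (not_le.2 h)

theorem stripKernel_of_abs_im_le {a T X : ℝ} {w : ℂ} (h0 : 0 ≤ w.re) (hX : w.re ≤ X)
    (hT : |w.im| ≤ T) :
    stripKernel a T X w = Real.sin (a * w.re) * Real.sinh (a * (T - |w.im|)) :=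
  if_pos ⟨⟨h0, hX⟩, hT⟩

theorem stripKernel_one_sub {a b T X : ℝ} {n : ℕ} (hab : a * (1 - 2 * b) = 2 * Real.pi * n)
    (hX : 1 - 2 * b ≤ X) {s : ℂ} (h0 : b ≤ s.re) (h1 : s.re ≤ 1 - b) :
    stripKernel a T X (1 - s - b) = -stripKernel a T X (s - b) := by
  have him : (1 - s - b : ℂ).im = -s.im := by simp
  have him' : (s - b : ℂ).im = s.im := by simp
  have hre : (1 - s - b : ℂ).re = 1 - s.re - b := by simp
  have hre' : (s - b : ℂ).re = s.re - b := by simp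
  by_cases hT : |s.im| ≤ T
  · rw [stripKernel_of_abs_im_le (by rw [hre]; linarith) (by rw [hre]; linarith)
        (by rwa [him, abs_neg]),
      stripKernel_of_abs_im_le (by rw [hre']; linarith) (by rw [hre']; linarith) (by rwa [him']),
      him, him', abs_neg, hre, hre']
    have e : a * (1 - s.re - b) = n * (2 * Real.pi) - a * (s.re - b) := by
      linear_combination hab
    rw [e, Real.sin_nat_mul_two_pi_sub, neg_mul]
  · rw [stripKernel, stripKernel, if_neg (fun h => hT ?_), if_neg (fun h => hT ?_), neg_zero]
    · rw [← him']; exact h.2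
    · rw [← abs_neg, ← him]; exact h.2

/-- Modulo 2π the angle is a(x - (1 - b)), and 0 < x - (1 - b) < b puts it in (0, π). -/
theorem sin_mul_sub_pos {a b x : ℝ} {n : ℕ} (ha : 0 < a)
    (hab : a * (1 - 2 * b) = 2 * Real.pi * n) (hb : a * b ≤ Real.pi) (h0 : 1 - b < x)
    (h1 : x < 1) : 0 < Real.sin (a * (x - b)) := by
  have e : a * (x - b) = a * (x - (1 - b)) + n * (2 * Real.pi) := by linear_combination hab
  rw [e, Real.sin_add_nat_mul_two_pi]
  refine Real.sin_pos_of_pos_of_lt_pi (mul_pos ha (by linarith)) ?_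
  nlinarith

open Classical in
/-- The contribution of a zero to the right of the line `re s = 1 - b`. -/
noncomputable def rightZeroTerm (a b T X : ℝ) (s : ℂ) : ℝ :=
  if 1 - b < s.re ∧ s ≠ 1 then (zetaOrder s : ℝ) * stripKernel a T X (s - b) else 0

theorem hasFiniteSupport_rightZeroTerm (a b T X : ℝ) :
    (rightZeroTerm a b T X).HasFiniteSupport := by
  refine (hasFiniteSupport_zetaOrder_mul_stripKernel a T X b).subset fun s hs => ?_
  rw [Function.mem_support, rightZeroTerm] at hs
  split_ifs at hs with h
  · exact hs
  · exact absurd rfl hs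

theorem finsum_zetaOrder_mul_stripKernel {a b T X : ℝ} {n : ℕ} (hb : 0 < b) (hb1 : b < 1)
    (hab : a * (1 - 2 * b) = 2 * Real.pi * n) (hT : 0 ≤ T) (hX : 1 ≤ X) :
    ∑ᶠ s : ℂ, (zetaOrder s : ℝ) * stripKernel a T X (s - b) =
      (∑ᶠ s, rightZeroTerm a b T X s) - Real.sin (a * (1 - b)) * Real.sinh (a * T) := by
  classical
  set g : ℂ → ℝ := fun s => (zetaOrder s : ℝ) * stripKernel a T X (s - b) with hg
  have hfin : g.HasFiniteSupport := hasFiniteSupport_zetaOrder_mul_stripKernel a T X b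
  set A : ℂ → ℝ := fun s => if s = 1 then g s else 0 with hA
  set B : ℂ → ℝ := fun s => if s.re ≤ 1 - b then g s else 0 with hB
  have hAfin : A.HasFiniteSupport := by
    refine hfin.subset fun s hs => ?_
    simp only [hA, Function.mem_support] at hs ⊢
    split_ifs at hs with h
    · exact hs
    · exact absurd rfl hs
  have hBfin : B.HasFiniteSupport := by
    refine hfin.subset fun s hs => ?_
    simp only [hB, Function.mem_support] at hs ⊢
    split_ifs at hs with h
    · exact hs
    · exact absurd rfl hs
  have hsplit : g = fun s => (rightZeroTerm a b T X s + B s) + A s := by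
    ext s
    simp only [hA, hB, rightZeroTerm]
    by_cases h1 : s = 1
    · subst h1
      simp [hb]
    · by_cases h2 : s.re ≤ 1 - b
      · simp [h1, h2, not_lt.2 h2]
      · simp [h1, h2, not_le.1 h2, hg]
  have hA1 : ∑ᶠ s, A s = -(Real.sin (a * (1 - b)) * Real.sinh (a * T)) := by
    rw [finsum_eq_single A 1 (fun s hs => if_neg hs)]
    simp only [hA, hg, if_true, zetaOrder_one]
    rw [stripKernel_of_abs_im_le (by simp; linarith) (by simp; linarith) (by simpa using hT)]
    simp
  -- B is odd under s ↦ 1 - s. Outside b ≤ Re s ≤ 1 - b it vanishes, by its cutoff on the right and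
  -- by the kernel's on the left.
  have hB0 : ∑ᶠ s, B s = 0 := by
    have hneg : ∀ s, B (1 - s) = -B s := by
      intro s
      have hre : (1 - s).re = 1 - s.re := by simp
      simp only [hB, hg]
      by_cases h0 : b ≤ s.re
      · by_cases h1 : s.re ≤ 1 - b
        · rw [if_pos (by rw [hre]; linarith), if_pos h1,
            zetaOrder_one_sub (by linarith) (by linarith),
            stripKernel_one_sub hab (by linarith) h0 h1, mul_neg]
        · rw [if_neg h1, stripKernel_of_re_neg (by simp; linarith)]
          simp
      · rw [if_neg (by rw [hre]; linarith), stripKernel_of_re_neg (by simp; linarith)]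
        simp
    have h := finsum_comp_equiv (Equiv.subLeft (1 : ℂ)) (f := B)
    simp only [Equiv.subLeft_apply, hneg, finsum_neg_distrib] at h
    linarith
  have e : ∑ᶠ s, g s = ∑ᶠ s, ((rightZeroTerm a b T X s + B s) + A s) := by rw [← hsplit]
  rw [e, finsum_add_distrib ((hasFiniteSupport_rightZeroTerm a b T X).fun_add hBfin) hAfin,
    finsum_add_distrib (hasFiniteSupport_rightZeroTerm a b T X) hBfin, hA1, hB0]
  ring

theorem rightZeroTerm_eq_zero {a b T X : ℝ} {s : ℂ}
    (h : ¬(riemannZeta s = 0 ∧ 1 - b < s.re)) : rightZeroTerm a b T X s = 0 := by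
  rw [rightZeroTerm]
  split_ifs with hs
  · rw [(zetaOrder_eq_zero_iff hs.2).2 fun h' => h ⟨h', hs.1⟩]
    simp
  · rfl

theorem re_lt_one_of_riemannZeta_eq_zero {s : ℂ} (h : riemannZeta s = 0) : s.re < 1 :=
  not_le.1 fun h' => riemannZeta_ne_zero_of_one_le_re h' h

theorem ne_one_of_riemannZeta_eq_zero {s : ℂ} (h : riemannZeta s = 0) : s ≠ 1 := by
  rintro rfl
  simpa using re_lt_one_of_riemannZeta_eq_zero h

theorem rightZeroTerm_nonneg {a b T X : ℝ} {n : ℕ} (ha : 0 < a)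
    (hab : a * (1 - 2 * b) = 2 * Real.pi * n) (hb : a * b ≤ Real.pi) (s : ℂ) :
    0 ≤ rightZeroTerm a b T X s := by
  by_cases h : riemannZeta s = 0 ∧ 1 - b < s.re
  · have h1 := re_lt_one_of_riemannZeta_eq_zero h.1
    have hs1 := ne_one_of_riemannZeta_eq_zero h.1
    rw [rightZeroTerm, if_pos ⟨h.2, hs1⟩, stripKernel]
    split_ifs with hK
    · refine mul_nonneg (by exact_mod_cast zetaOrder_nonneg hs1) (mul_nonneg ?_ ?_)
      · have := sin_mul_sub_pos ha hab hb h.2 h1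
        simpa using this.le
      · exact Real.sinh_nonneg_iff.2 (mul_nonneg ha.le (by linarith [hK.2]))
    · simp
  · rw [rightZeroTerm_eq_zero h]

theorem tendsto_finsum_rightZeroTerm {a b : ℝ} {n : ℕ} (ha : 0 < a) (hb : 0 < b) (hb1 : b < 1)
    (hab : a * (1 - 2 * b) = 2 * Real.pi * n) :
    Tendsto (fun N : ℕ => Real.pi / a *
      ((∑ᶠ s, rightZeroTerm a b N (N * (Real.pi / a)) s) / Real.sinh (a * N))) atTop
      (𝓝 ((∫ t in Ioi (0 : ℝ), Real.exp (-(a * t)) * Real.log ‖riemannZeta (b + I * t)‖) -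
        (∫ x in Ioi (0 : ℝ), Real.sin (a * x) * Real.log ‖riemannZeta (b + x)‖) +
        Real.pi / a * Real.sin (a * (1 - b)))) := by
  have h := (tendsto_stripFunctional_riemannZeta ha hb (by linarith)).add_const
    (Real.pi / a * Real.sin (a * (1 - b)))
  refine h.congr' ?_
  have hX : Tendsto (fun N : ℕ => (N : ℝ) * (Real.pi / a)) atTop atTop :=
    tendsto_natCast_atTop_atTop.atTop_mul_const (by positivity)
  filter_upwards [hX.eventually_ge_atTop 1, eventually_ge_atTop 1] with N hN hN1
  have hN0 : (0 : ℝ) < N := by exact_mod_cast hN1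
  have hsp : 0 < Real.sinh (a * N) := Real.sinh_pos_iff.2 (mul_pos ha hN0)
  have hsin : Real.sin (a * (N * (Real.pi / a))) = 0 := by
    rw [← Real.sin_nat_mul_pi N]
    congr 1
    field_simp
  rw [stripFunctional_log_riemannZeta_add hN0.le (by linarith) hsin,
    finsum_zetaOrder_mul_stripKernel hb hb1 hab hN0.le hN]
  field_simp
  ring

theorem integral_formula_eq_zero_iff {a b : ℝ} {n : ℕ} (ha : 0 < a) (hb : 0 < b) (hb1 : b < 1 / 2)
    (hab : a * (1 - 2 * b) = 2 * Real.pi * n) (hpi : a * b ≤ Real.pi) :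
    (∫ t in Ioi (0 : ℝ), Real.exp (-(a * t)) * Real.log ‖riemannZeta (b + I * t)‖) -
        (∫ x in Ioi (0 : ℝ), Real.sin (a * x) * Real.log ‖riemannZeta (b + x)‖) +
        Real.pi / a * Real.sin (a * (1 - b)) = 0 ↔
      ¬∃ s : ℂ, riemannZeta s = 0 ∧ 1 - b < s.re := by
  have hlim := tendsto_finsum_rightZeroTerm ha hb (by linarith) hab
  constructor
  · rintro h ⟨s, hs, hsb⟩
    rw [h] at hlim
    have h1 := re_lt_one_of_riemannZeta_eq_zero hs
    have hs1 := ne_one_of_riemannZeta_eq_zero hs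
    have hsin := sin_mul_sub_pos ha hab hpi hsb h1
    have hm : (0 : ℝ) < zetaOrder s := by exact_mod_cast zetaOrder_pos hs1 hs
    have hX : Tendsto (fun N : ℕ => (N : ℝ) * (Real.pi / a)) atTop atTop :=
      tendsto_natCast_atTop_atTop.atTop_mul_const (by positivity)
    -- The term of the single zero s bounds the nonnegative sum from below, and its limit is a
    -- positive multiple of exp(-a|Im s|).
    have h2 := (((tendsto_cosh_div_sinh ha).mul_const (Real.sinh (a * |s.im|))).const_sub
      (Real.cosh (a * |s.im|))).const_mul
      (Real.pi / a * (zetaOrder s * Real.sin (a * (s.re - b))))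
    rw [one_mul, Real.cosh_sub_sinh] at h2
    have h3 := le_of_tendsto_of_tendsto h2 hlim ?_
    · have : 0 < Real.pi / a * (zetaOrder s * Real.sin (a * (s.re - b))) *
          Real.exp (-(a * |s.im|)) := by positivity
      linarith
    · filter_upwards [hX.eventually_ge_atTop 1, eventually_ge_atTop 1,
        tendsto_natCast_atTop_atTop.eventually_ge_atTop |s.im|] with N hN hN1 hNs
      have hN0 : (0 : ℝ) < N := by exact_mod_cast hN1
      have hsp : 0 < Real.sinh (a * N) := Real.sinh_pos_iff.2 (mul_pos ha hN0)
      have h4 := single_le_finsum s (hasFiniteSupport_rightZeroTerm a b N (N * (Real.pi / a)))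
        (rightZeroTerm_nonneg ha hab hpi)
      rw [← sinh_sub_div_sinh hsp.ne', mul_assoc]
      gcongr
      rw [← mul_div_assoc]
      gcongr
      refine le_trans (le_of_eq ?_) h4
      rw [rightZeroTerm, if_pos ⟨hsb, hs1⟩, stripKernel_of_abs_im_le (by simp; linarith)
        (by simp; linarith) (by simpa using hNs)]
      simp [mul_assoc]
  · intro h
    refine tendsto_nhds_unique hlim (tendsto_const_nhds.congr fun N => ?_)
    have h0 : ∀ s, rightZeroTerm a b N (N * (Real.pi / a)) s = 0 := fun s =>
      rightZeroTerm_eq_zero fun hs => h ⟨s, hs⟩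
    simp [h0]

theorem riemannZeta_one_sub_eq_zero {s : ℂ} (h0 : 0 < s.re) (h1 : s.re < 1)
    (h : riemannZeta s = 0) : riemannZeta (1 - s) = 0 := by
  rw [riemannZeta_one_sub _ (ne_one_of_riemannZeta_eq_zero h), h, mul_zero]
  rintro n rfl
  simp only [neg_re, natCast_re, Left.neg_pos_iff] at h0
  exact absurd h0 (not_lt.2 n.cast_nonneg)

/-- With s = 1 - z and Re z ≥ 1, only the cosine in the functional equation can vanish, so z is an
odd integer. The value z = 1 is excluded by ζ(0) ≠ 0, and z ≥ 3 makes s trivial. -/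
theorem IsNontrivialZetaZero.re_pos {s : ℂ} (hs : IsNontrivialZetaZero s) : 0 < s.re := by
  by_contra! hre
  obtain ⟨z, rfl⟩ : ∃ z, s = 1 - z := ⟨1 - s, by ring⟩
  have hz : 1 ≤ z.re := by simpa using hre
  have hz1 : z ≠ 1 := by
    rintro rfl
    have := hs.1
    rw [sub_self, riemannZeta_zero] at this
    norm_num at this
  have hn : ∀ n : ℕ, z ≠ -n := by
    rintro n rfl
    simp only [neg_re, natCast_re] at hz
    linarith [(n.cast_nonneg : (0 : ℝ) ≤ n)]
  have h := hs.1
  have h2pi : (2 * Real.pi : ℂ) ≠ 0 := by exact_mod_cast Real.two_pi_pos.ne'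
  have hpow : (2 * Real.pi : ℂ) ^ (-z) ≠ 0 := by simp [cpow_eq_zero_iff, h2pi]
  rw [riemannZeta_one_sub hn hz1] at h
  simp only [mul_eq_zero, two_ne_zero, hpow, Gamma_ne_zero hn,
    riemannZeta_ne_zero_of_one_le_re hz, or_false, false_or] at h
  obtain ⟨k, rfl⟩ := cos_pi_mul_div_two_eq_zero_iff.1 h
  have e : (2 * (k : ℂ) + 1).re = ((2 * k + 1 : ℤ) : ℝ) := by simp
  rw [e] at hz
  have hk : 1 ≤ 2 * k + 1 := by exact_mod_cast hz
  have hk0 : k ≠ 0 := by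
    rintro rfl
    simp at hz1
  obtain ⟨m, rfl⟩ : ∃ m : ℕ, k = m + 1 := ⟨(k - 1).toNat, by omega⟩
  refine hs.2 ⟨m, ?_⟩
  push_cast
  ring

theorem exists_nontrivialZetaZero_re_lt_iff {b : ℝ} (hb1 : b < 1) :
    (∃ s : ℂ, IsNontrivialZetaZero s ∧ s.re < b) ↔ ∃ s : ℂ, riemannZeta s = 0 ∧ 1 - b < s.re := by
  constructor
  · rintro ⟨s, hs, hsb⟩
    exact ⟨1 - s, riemannZeta_one_sub_eq_zero hs.re_pos (by linarith) hs.1, by simpa using hsb⟩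
  · rintro ⟨s, hs, hsb⟩
    have h1 := re_lt_one_of_riemannZeta_eq_zero hs
    refine ⟨1 - s, ⟨riemannZeta_one_sub_eq_zero (by linarith) h1 hs, ?_⟩, by
      simp only [sub_re, one_re]; linarith⟩
    rintro ⟨k, hk⟩
    have := congrArg re hk
    simp at this
    linarith [(k.cast_nonneg : (0 : ℝ) ≤ k)]

end ZeroSum

/-! ### The criterion and its case b = 1/4. -/

theorem mainTheorem6 :
    (∀ (a b : ℝ) (n : ℕ), 0 < b → b ≤ 1 / 4 → 0 < n → (n : ℝ) ≤ 1 / (2 * b) - 1 →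
      a = Real.pi * n / (1 / 2 - b) →
      MeasureTheory.IntegrableOn
        (fun t : ℝ => Real.exp (-(a * t)) *
          Real.log ‖riemannZeta ((b : ℂ) + Complex.I * (t : ℂ))‖) (Set.Ioi 0) ∧
      MeasureTheory.IntegrableOn
        (fun x : ℝ => Real.sin (a * x) *
          Real.log ‖riemannZeta ((b : ℂ) + (x : ℂ))‖) (Set.Ioi 0) ∧
      ((∫ t in Set.Ioi (0 : ℝ), Real.exp (-(a * t)) *
            Real.log ‖riemannZeta ((b : ℂ) + Complex.I * (t : ℂ))‖)
          - (∫ x in Set.Ioi (0 : ℝ), Real.sin (a * x) *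
            Real.log ‖riemannZeta ((b : ℂ) + (x : ℂ))‖)
          + Real.pi / a * Real.sin (a * (1 - b)) = 0
        ↔ ¬ ∃ s : ℂ, IsNontrivialZetaZero s ∧ s.re < b)) ∧
    ((∫ t in Set.Ioi (0 : ℝ), Real.exp (-(4 * Real.pi * t)) *
          Real.log ‖riemannZeta ((1 / 4 : ℂ) + Complex.I * (t : ℂ))‖)
        - (∫ x in Set.Ioi (0 : ℝ), Real.sin (4 * Real.pi * x) *
          Real.log ‖riemannZeta ((1 / 4 : ℂ) + (x : ℂ))‖) = 0
      ↔ ¬ ∃ s : ℂ, IsNontrivialZetaZero s ∧ s.re < 1 / 4) := by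
  have main : ∀ (a b : ℝ) (n : ℕ), 0 < b → b ≤ 1 / 4 → 0 < n → (n : ℝ) ≤ 1 / (2 * b) - 1 →
      a = Real.pi * n / (1 / 2 - b) → _ := fun a b n hb hb4 hn hnb ha => by
    have hb2 : 0 < 1 / 2 - b := by linarith
    have hn0 : (0 : ℝ) < n := by exact_mod_cast hn
    have ha0 : 0 < a := by rw [ha]; positivity
    have hab : a * (1 - 2 * b) = 2 * Real.pi * n := by
      rw [ha, div_mul_eq_mul_div, div_eq_iff hb2.ne']
      ring
    have hpi : a * b ≤ Real.pi := by
      have h1 : n * b ≤ 1 / 2 - b := by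
        have := mul_le_mul_of_nonneg_right hnb hb.le
        have e : (1 / (2 * b) - 1) * b = 1 / 2 - b := by field_simp
        linarith
      rw [ha, div_mul_eq_mul_div, div_le_iff₀ hb2, mul_assoc]
      exact mul_le_mul_of_nonneg_left h1 Real.pi_pos.le
    exact And.intro (integrableOn_exp_mul_log_riemannZeta ha0 hb (by linarith))
      (And.intro (integrableOn_sin_mul_log_riemannZeta a hb)
        ((integral_formula_eq_zero_iff ha0 hb (by linarith) hab hpi).trans
          (not_congr (exists_nontrivialZetaZero_re_lt_iff (by linarith)).symm)))
  refine ⟨main, ?_⟩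
  have h := (main (4 * Real.pi) (1 / 4) 1 (by norm_num) le_rfl one_pos (by norm_num)
    (by push_cast; ring)).2.2
  have hsin : Real.sin (4 * Real.pi * (1 - 1 / 4)) = 0 := by
    rw [show 4 * Real.pi * (1 - 1 / 4) = (3 : ℕ) * Real.pi by push_cast; ring]
    exact Real.sin_nat_mul_pi 3
  rw [hsin, mul_zero, add_zero] at h
  have e : (((1 / 4 : ℝ) : ℝ) : ℂ) = 1 / 4 := by push_cast; rfl
  rwa [e] at h
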